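/- Let $W\in\mathbb R^{s\times m}$, $q\in\mathbb R^m$, let $\|\cdot\|$ be the Euclidean norm and $B_\rho(0)$ the ball of radius $\rho$ in $\mathbb R^s$, and let $\varphi(t)=\min\{q^\top y \mid Wy=t,\ y\ge 0\}$ for $t\in\mathbb R^s$. For a Borel probability measure $\mu$ on $\mathbb R^s$ put $$Q_{EE}(x,\eta)=\int_{\mathbb R^s}\max\{0,\varphi(z-x)-\eta\}\,\mu(dz),\qquad (x,\eta)\in\mathbb R^s\times\mathbb R .$$ Let $d_i$ ($i\in I$) be the extreme points of $\{v\mid W^\top v\le q\}$, let $K_i=\{z\mid (d_i-d_j)^\top z\ge 0\ \forall j\in I\}$, $K_i^+=K_i\cap\{z\mid d_i^\top z\ge 0\}$ and $I^+=\{i\in I\mid \operatorname{int}K_i^+\ne\emptyset,\ d_i\neq 0\}$. For $\eta>0$ and $i\in I^+$ let $\hat y^i(\eta)$ be a point of minimum norm among the points in which the hyperplane $\{z\mid d_i^\top z=\eta\}$ meets an extreme ray of $K_i$. Assume: * A1: for every $t\in\mathbb R^s$ there is $y\ge 0$ with $Wy=t$; * A2: there is $v$ with $W^\top v<q$ (componentwise);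 * A3: $\int\|z\|\,\mu(dz)<\infty$; * A4: $\mu$ has a Lebesgue density $\theta$, and there are a convex open set $V\subset\mathbb R^s$ and constants $r,\rho>0$ with $\theta\ge r$ Lebesgue-almost everywhere on $V+B_\rho(0)$; * A5: $\eta_0>0$ satisfies $\|\hat y^i(\eta_0)\|<\rho$ for all $i\in I^+$. Let $I^{\pm}$ be the set of $i\in I^+$ for which both $K_i\cap\{z\mid d_i^\top z\ge\eta_0\}$ and $K_i\cap\{z\mid d_i^\top z\le\eta_0\}$ are unbounded, and $I^{++}$ the set of $i\in I^+$ for which only the first of them is unbounded. For $i\in I^{++}$ let $\alpha_i'>0$ be such that $d_i^\top u\ge\alpha_i'\|u\|$ for all $u\in K_i$. For $j\in I^{\pm}$ let $0<\gamma_j'<\gamma_j$, where $\gamma_j=d_j^\top\hat y^j(\eta_0)/\|\hat y^j(\eta_0)\|$ (for example $\gamma_j'=\gamma_j/2$). Put $\delta=\max\{\alpha_i',\gamma_j'\mid i\in I^{++},\ j\in I^{\pm}\}$ (if $I^+=\emptyset$, which happens only for $s=0$, $\delta$ is irrelevant). Then $Q_{EE}$ is well defined (the integrand is $\mu$-integrable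 for all $(x,\eta)$), and there is $\kappa>0$ such that for every set $\Omega\subset V\times(-\infty,\eta_0]$ with the property $$\eta'-\eta\ \ge\ -\tfrac{\delta}{3}\,\|y-x\|\qquad\text{for all }(x,\eta),(y,\eta')\in\Omega\text{ such that } y-x\in K_i\text{ for some } i\in I^+,$$ $Q_{EE}$ is restricted partially $\kappa$-strongly convex on $\Omega$ with respect to its first argument, i.e. $$Q_{EE}\big(\lambda(x_1,\eta_1)+(1-\lambda)(x_2,\eta_2)\big)\le\lambda Q_{EE}(x_1,\eta_1)+(1-\lambda)Q_{EE}(x_2,\eta_2)-\tfrac{\kappa}{2}\lambda(1-\lambda)\|x_1-x_2\|^2$$ for all $(x_1,\eta_1),(x_2,\eta_2)\in\Omega$ and all $0<\lambda<1$. -/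

import Mathlib

open MeasureTheory
open scoped Pointwise

namespace TwoStage

variable {s m : ℕ}

/-- Recourse value function `φ(t) = min { qᵀ y | W y = t, y ≥ 0 }`. -/
noncomputable def recourseValue (W : Matrix (Fin s) (Fin m) ℝ) (q : Fin m → ℝ)
    (t : EuclideanSpace ℝ (Fin s)) : ℝ :=
  sInf {c : ℝ | ∃ y : Fin m → ℝ, 0 ≤ y ∧ W.mulVec y = t.ofLp ∧ c = q ⬝ᵥ y}

/-- Expected excess `Q_EE(x, η) = E_μ [ max {0, φ(z - x) - η} ]`, as a function of the pair `(x, η)`. -/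
noncomputable def expectedExcess (W : Matrix (Fin s) (Fin m) ℝ) (q : Fin m → ℝ)
    (μ : Measure (EuclideanSpace ℝ (Fin s))) (p : EuclideanSpace ℝ (Fin s) × ℝ) : ℝ :=
  ∫ z, max 0 (recourseValue W q (z - p.1) - p.2) ∂μ

/-- Complete recourse. -/
def CompleteRecourse (W : Matrix (Fin s) (Fin m) ℝ) : Prop :=
  ∀ t : Fin s → ℝ, ∃ y : Fin m → ℝ, 0 ≤ y ∧ W.mulVec y = t

/-- Strengthened sufficiently expensive recourse. -/
def SufficientlyExpensive (W : Matrix (Fin s) (Fin m) ℝ) (q : Fin m → ℝ) : Prop :=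
  ∃ v : Fin s → ℝ, ∀ j, W.transpose.mulVec v j < q j

/-- `μ` has a Lebesgue density `θ` with `θ ≥ r` Lebesgue-almost everywhere on `V + B_ρ(0)`. -/
def HasDensityBound (μ : Measure (EuclideanSpace ℝ (Fin s)))
    (V : Set (EuclideanSpace ℝ (Fin s))) (r ρ : ℝ) : Prop :=
  ∃ θ : EuclideanSpace ℝ (Fin s) → ℝ, Measurable θ ∧ (∀ z, 0 ≤ θ z) ∧
    μ = (volume : Measure (EuclideanSpace ℝ (Fin s))).withDensity
      (fun z => ENNReal.ofReal (θ z)) ∧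
    ∀ᵐ z ∂(volume : Measure (EuclideanSpace ℝ (Fin s))),
      z ∈ V + Metric.ball (0 : EuclideanSpace ℝ (Fin s)) ρ → r ≤ θ z

/-- The dual polyhedron `{ v | Wᵀ v ≤ q }`. -/
def dualPolyhedron (W : Matrix (Fin s) (Fin m) ℝ) (q : Fin m → ℝ) :
    Set (EuclideanSpace ℝ (Fin s)) :=
  {v | ∀ j, W.transpose.mulVec v.ofLp j ≤ q j}

/-- The extreme points `d_i`, `i ∈ I`, of the dual polyhedron; the index `i` is identified with the
point `d_i` itself. -/
def dualVertices (W : Matrix (Fin s) (Fin m) ℝ) (q : Fin m → ℝ) :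
    Set (EuclideanSpace ℝ (Fin s)) :=
  (dualPolyhedron W q).extremePoints ℝ

/-- The linearity cone `K_i = { z | (d_i - d_j)ᵀ z ≥ 0 for all j ∈ I }` belonging to `d = d_i`. -/
def linCone (W : Matrix (Fin s) (Fin m) ℝ) (q : Fin m → ℝ) (d : EuclideanSpace ℝ (Fin s)) :
    Set (EuclideanSpace ℝ (Fin s)) :=
  {z | ∀ d' ∈ dualVertices W q, 0 ≤ inner ℝ (d - d') z}

/-- `K_i⁺ = K_i ∩ { z | d_iᵀ z ≥ 0 }`. -/
def linConePos (W : Matrix (Fin s) (Fin m) ℝ) (q : Fin m → ℝ) (d : EuclideanSpace ℝ (Fin s)) :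
    Set (EuclideanSpace ℝ (Fin s)) :=
  linCone W q d ∩ {z | 0 ≤ inner ℝ d z}

/-- The index set `I⁺`. -/
def indexPos (W : Matrix (Fin s) (Fin m) ℝ) (q : Fin m → ℝ) : Set (EuclideanSpace ℝ (Fin s)) :=
  {d ∈ dualVertices W q | (interior (linConePos W q d)).Nonempty ∧ d ≠ 0}

/-- `t` spans an extreme ray of the convex cone `K`. -/
def IsExtremeRay (K : Set (EuclideanSpace ℝ (Fin s))) (t : EuclideanSpace ℝ (Fin s)) : Prop :=
  t ∈ K ∧ t ≠ 0 ∧ ∀ a ∈ K, ∀ b ∈ K, a + b = t → ∃ c : ℝ, 0 ≤ c ∧ a = c • t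

/-- For `η > 0`: the points in which the hyperplane `{ z | d_iᵀ z = η }` meets an extreme ray
of `K_i`. -/
def raySection (W : Matrix (Fin s) (Fin m) ℝ) (q : Fin m → ℝ) (d : EuclideanSpace ℝ (Fin s))
    (η : ℝ) : Set (EuclideanSpace ℝ (Fin s)) :=
  {y | IsExtremeRay (linCone W q d) y ∧ inner ℝ d y = η}

/-- `y` is a possible choice of `ŷⁱ(η)`: a point of `raySection` of minimum norm. -/
def IsMinRayPoint (W : Matrix (Fin s) (Fin m) ℝ) (q : Fin m → ℝ) (d : EuclideanSpace ℝ (Fin s))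
    (η : ℝ) (y : EuclideanSpace ℝ (Fin s)) : Prop :=
  y ∈ raySection W q d η ∧ ∀ y' ∈ raySection W q d η, ‖y‖ ≤ ‖y'‖

/-- `M_i⁺(0, η) = K_i ∩ { z | d_iᵀ z ≥ η }`. -/
def slabAbove (W : Matrix (Fin s) (Fin m) ℝ) (q : Fin m → ℝ) (d : EuclideanSpace ℝ (Fin s))
    (η : ℝ) : Set (EuclideanSpace ℝ (Fin s)) :=
  linCone W q d ∩ {z | η ≤ inner ℝ d z}

/-- `M_i⁻(0, η) = K_i ∩ { z | d_iᵀ z ≤ η }`. -/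
def slabBelow (W : Matrix (Fin s) (Fin m) ℝ) (q : Fin m → ℝ) (d : EuclideanSpace ℝ (Fin s))
    (η : ℝ) : Set (EuclideanSpace ℝ (Fin s)) :=
  linCone W q d ∩ {z | inner ℝ d z ≤ η}

/-- `I^±` (for `η > 0`): indices in `I⁺` for which both slabs are unbounded. -/
def indexBoth (W : Matrix (Fin s) (Fin m) ℝ) (q : Fin m → ℝ) (η : ℝ) :
    Set (EuclideanSpace ℝ (Fin s)) :=
  {d ∈ indexPos W q | ¬ Bornology.IsBounded (slabAbove W q d η) ∧
    ¬ Bornology.IsBounded (slabBelow W q d η)}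

/-- `I⁺⁺` (for `η > 0`): indices in `I⁺` for which only the upper slab is unbounded. -/
def indexOnlyAbove (W : Matrix (Fin s) (Fin m) ℝ) (q : Fin m → ℝ) (η : ℝ) :
    Set (EuclideanSpace ℝ (Fin s)) :=
  {d ∈ indexPos W q | ¬ Bornology.IsBounded (slabAbove W q d η) ∧
    Bornology.IsBounded (slabBelow W q d η)}

/-- `η₀` is small compared with `ρ`: `‖ŷⁱ(η₀)‖ < ρ` for all `i ∈ I⁺`. -/
def ThresholdBound (W : Matrix (Fin s) (Fin m) ℝ) (q : Fin m → ℝ) (ρ η₀ : ℝ) : Prop :=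
  ∀ d ∈ indexPos W q, ∀ y, IsMinRayPoint W q d η₀ y → ‖y‖ < ρ

/-- Admissible constants `α'_i`, `i ∈ I⁺⁺`: `α'_i > 0` and `d_iᵀ u ≥ α'_i ‖u‖` on `K_i`. -/
def IsLowerSlope (W : Matrix (Fin s) (Fin m) ℝ) (q : Fin m → ℝ) (η : ℝ)
    (α' : EuclideanSpace ℝ (Fin s) → ℝ) : Prop :=
  ∀ d ∈ indexOnlyAbove W q η, 0 < α' d ∧ ∀ u ∈ linCone W q d, α' d * ‖u‖ ≤ inner ℝ d u

/-- Admissible constants `γ'_i`, `i ∈ I^±`: `0 < γ'_i < γ_i`, where `γ_i = d_iᵀ tⁱ` and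
`tⁱ = ŷⁱ / ‖ŷⁱ‖`. -/
def IsCutSlope (W : Matrix (Fin s) (Fin m) ℝ) (q : Fin m → ℝ) (η : ℝ)
    (γ' : EuclideanSpace ℝ (Fin s) → ℝ) : Prop :=
  ∀ d ∈ indexBoth W q η, 0 < γ' d ∧
    ∀ y, IsMinRayPoint W q d η y → γ' d < inner ℝ d (‖y‖⁻¹ • y)

/-- `δ = max { α'_i, γ'_j | i ∈ I⁺⁺, j ∈ I^± }`, a maximum over a finite set (if the set is empty,
`δ` plays no role). -/
noncomputable def slopeMax (W : Matrix (Fin s) (Fin m) ℝ) (q : Fin m → ℝ) (η : ℝ)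
    (α' γ' : EuclideanSpace ℝ (Fin s) → ℝ) : ℝ :=
  sSup (α' '' indexOnlyAbove W q η ∪ γ' '' indexBoth W q η)

/-- `Ω ⊆ V × (-∞, η₀]`, and `η' - η ≥ -(δ/3) ‖y - x‖` for all `(x, η), (y, η') ∈ Ω` such that
`y - x ∈ K_i` for some `i ∈ I⁺`. -/
def IsAdmissibleSet (W : Matrix (Fin s) (Fin m) ℝ) (q : Fin m → ℝ)
    (V : Set (EuclideanSpace ℝ (Fin s))) (η₀ δ : ℝ)
    (Ω : Set (EuclideanSpace ℝ (Fin s) × ℝ)) : Prop :=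
  Ω ⊆ V ×ˢ Set.Iic η₀ ∧
    ∀ p ∈ Ω, ∀ p' ∈ Ω, ∀ d ∈ indexPos W q, p'.1 - p.1 ∈ linCone W q d →
      p'.2 - p.2 ≥ -(δ / 3) * ‖p'.1 - p.1‖

/-- `f` is restricted partially `κ`-strongly convex on `Ω` with respect to its first argument. -/
def RestrictedPartiallyStronglyConvex (κ : ℝ) (Ω : Set (EuclideanSpace ℝ (Fin s) × ℝ))
    (f : EuclideanSpace ℝ (Fin s) × ℝ → ℝ) : Prop :=
  ∀ p₁ ∈ Ω, ∀ p₂ ∈ Ω, ∀ l : ℝ, 0 < l → l < 1 →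
    f (l • p₁ + (1 - l) • p₂) ≤
      l * f p₁ + (1 - l) * f p₂ - κ / 2 * l * (1 - l) * ‖p₁.1 - p₂.1‖ ^ 2

end TwoStage

/-! By linear programming duality `φ` is the support function of the dual polyhedron `D`, which is
compact by A1 and contains a ball by A2. So `φ` is sublinear, Lipschitz and linear on each of
finitely many cones `K_i`, and `F(t, η) = max {0, φ(t) - η}` is jointly convex and piecewise linear.
Along a segment with direction `(u, c)` in `(x, η)`, the second difference of `Q_EE` with step `ε`
is the `μ`-integral of the nonnegative second difference of `F(z - x, η)`, hence at least `r` times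
its Lebesgue integral over `B_ρ(0)`. It remains to bound that integral below by a uniform multiple
of `‖u‖² ε²`.

The analytic core is `le_integral_secondDiff_of_isLinearNear`, a discrete Cauchy-Schwarz inequality
for the Hessian of a convex function. If `F` is linear near two balls inside `B_ρ(0)`, and the two
slopes in direction `(-u, c)` differ by `K`, then the integrated second difference is at least a
constant times `K² ε²`. No information about `F` between the balls is needed.

The geometric core, `exists_secondDiff_excess_bound`, chooses the balls. Where `F` equals `φ - η`,
the cones containing `u` and `-u` serve, with `K = φ(u) + φ(-u)` up to sign; this is at least
`2σ‖u‖` because `D` contains a ball. Otherwise one ball lies where `F = 0` and the other in some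
`K_i`, `i ∈ I⁺`, above the threshold (A5), with `|K| = |d_iᵀu + c|`. This could vanish for all `i ∈
I⁺` only if all `d_i` agreed on `u`, which forces `δ ≤ φ(u)/‖u‖` (`slopeMax_le_of_forall_inner_eq`)
and contradicts `c ≥ -(δ/3)‖u‖`. Compactness and finiteness make the constants uniform. -/

namespace TwoStage

/-! ### Linear programming duality: `φ` as the support function of a compact polyhedron with
interior. -/

section Duality

open scoped InnerProductSpace

variable {s m : ℕ} {W : Matrix (Fin s) (Fin m) ℝ} {q : Fin m → ℝ}

/-- A linear functional attains its maximum over a nonempty compact set at an extreme point. -/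
theorem exists_extremePoint_forall_inner_le {C : Set (EuclideanSpace ℝ (Fin s))}
    (hC : IsCompact C) (hne : C.Nonempty) (w : EuclideanSpace ℝ (Fin s)) :
    ∃ z ∈ C.extremePoints ℝ, ∀ y ∈ C, ⟪w, y⟫_ℝ ≤ ⟪w, z⟫_ℝ := by
  obtain ⟨x, hxC, hx⟩ := hC.exists_isMaxOn hne
    ((continuous_const.inner continuous_id).continuousOn : ContinuousOn (fun y => ⟪w, y⟫_ℝ) C)
  have hexp : IsExposed ℝ C ((innerSL ℝ w).toExposed C) :=
    ContinuousLinearMap.toExposed.isExposed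
  have hne' : ((innerSL ℝ w).toExposed C).Nonempty := ⟨x, hxC, fun y hy => by simpa using hx hy⟩
  obtain ⟨z, hz⟩ := (hexp.isCompact hC).extremePoints_nonempty hne'
  refine ⟨z, hexp.isExtreme.extremePoints_subset_extremePoints hz, fun y hy => ?_⟩
  simpa using hz.1.2 y hy

theorem inner_mulVec_eq (v t : EuclideanSpace ℝ (Fin s)) (y : Fin m → ℝ)
    (h : W.mulVec y = t.ofLp) : ⟪v, t⟫_ℝ = W.transpose.mulVec v.ofLp ⬝ᵥ y := by
  rw [EuclideanSpace.inner_eq_star_dotProduct, ← h, Matrix.mulVec_transpose,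
    ← Matrix.dotProduct_mulVec, dotProduct_comm]
  simp

theorem inner_le_of_mem_dualPolyhedron {v t : EuclideanSpace ℝ (Fin s)}
    (hv : v ∈ dualPolyhedron W q) {y : Fin m → ℝ} (hy : 0 ≤ y) (h : W.mulVec y = t.ofLp) :
    ⟪v, t⟫_ℝ ≤ q ⬝ᵥ y := by
  rw [inner_mulVec_eq v t y h]
  exact Finset.sum_le_sum fun j _ => mul_le_mul_of_nonneg_right (hv j) (hy j)

theorem dualPolyhedron_nonempty (h2 : SufficientlyExpensive W q) :
    (dualPolyhedron W q).Nonempty := by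
  obtain ⟨v, hv⟩ := h2
  exact ⟨WithLp.toLp 2 v, fun j => (hv j).le⟩

theorem bddBelow_costs (h2 : SufficientlyExpensive W q) (t : EuclideanSpace ℝ (Fin s)) :
    BddBelow {c : ℝ | ∃ y : Fin m → ℝ, 0 ≤ y ∧ W.mulVec y = t.ofLp ∧ c = q ⬝ᵥ y} := by
  obtain ⟨v, hv⟩ := dualPolyhedron_nonempty h2
  refine ⟨⟪v, t⟫_ℝ, ?_⟩
  rintro c ⟨y, hy, hyt, rfl⟩
  exact inner_le_of_mem_dualPolyhedron hv hy hyt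

theorem costs_nonempty (h1 : CompleteRecourse W) (t : EuclideanSpace ℝ (Fin s)) :
    {c : ℝ | ∃ y : Fin m → ℝ, 0 ≤ y ∧ W.mulVec y = t.ofLp ∧ c = q ⬝ᵥ y}.Nonempty := by
  obtain ⟨y, hy, hyt⟩ := h1 t.ofLp
  exact ⟨_, y, hy, hyt, rfl⟩

theorem recourseValue_le (h2 : SufficientlyExpensive W q) {t : EuclideanSpace ℝ (Fin s)}
    {y : Fin m → ℝ} (hy : 0 ≤ y) (hyt : W.mulVec y = t.ofLp) :
    recourseValue W q t ≤ q ⬝ᵥ y :=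
  csInf_le (bddBelow_costs h2 t) ⟨y, hy, hyt, rfl⟩

theorem le_recourseValue (h1 : CompleteRecourse W) {t : EuclideanSpace ℝ (Fin s)} {a : ℝ}
    (h : ∀ y : Fin m → ℝ, 0 ≤ y → W.mulVec y = t.ofLp → a ≤ q ⬝ᵥ y) :
    a ≤ recourseValue W q t := by
  refine le_csInf (costs_nonempty h1 t) ?_
  rintro c ⟨y, hy, hyt, rfl⟩
  exact h y hy hyt

theorem inner_le_recourseValue (h1 : CompleteRecourse W) {v : EuclideanSpace ℝ (Fin s)}
    (hv : v ∈ dualPolyhedron W q) (t : EuclideanSpace ℝ (Fin s)) :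
    ⟪v, t⟫_ℝ ≤ recourseValue W q t :=
  le_recourseValue h1 fun _ hy hyt => inner_le_of_mem_dualPolyhedron hv hy hyt

theorem recourseValue_smul_le (h1 : CompleteRecourse W) (h2 : SufficientlyExpensive W q)
    {c : ℝ} (hc : 0 < c) (t : EuclideanSpace ℝ (Fin s)) :
    recourseValue W q (c • t) ≤ c * recourseValue W q t := by
  rw [← div_le_iff₀' hc]
  refine le_recourseValue h1 fun y hy hyt => ?_
  rw [div_le_iff₀' hc]
  have := recourseValue_le (W := W) (q := q) h2 (t := c • t) (y := c • y)
    (smul_nonneg hc.le hy) (by rw [Matrix.mulVec_smul, hyt]; rfl)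
  simpa [dotProduct_smul] using this

theorem recourseValue_smul (h1 : CompleteRecourse W) (h2 : SufficientlyExpensive W q)
    {c : ℝ} (hc : 0 < c) (t : EuclideanSpace ℝ (Fin s)) :
    recourseValue W q (c • t) = c * recourseValue W q t := by
  refine le_antisymm (recourseValue_smul_le h1 h2 hc t) ?_
  have := recourseValue_smul_le h1 h2 (inv_pos.2 hc) (c • t)
  rw [smul_smul, inv_mul_cancel₀ hc.ne', one_smul] at this
  rwa [le_inv_mul_iff₀ hc] at this

theorem recourseValue_add_le (h1 : CompleteRecourse W) (h2 : SufficientlyExpensive W q)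
    (t t' : EuclideanSpace ℝ (Fin s)) :
    recourseValue W q (t + t') ≤ recourseValue W q t + recourseValue W q t' := by
  rw [← sub_le_iff_le_add]
  refine le_recourseValue h1 fun y hy hyt => ?_
  rw [sub_le_comm]
  refine le_recourseValue h1 fun y' hy' hyt' => ?_
  rw [sub_le_iff_le_add', ← dotProduct_add]
  exact recourseValue_le h2 (add_nonneg hy hy') (by rw [Matrix.mulVec_add, hyt, hyt']; rfl)

/-- Strong duality by Hahn-Banach: the functional `c • t ↦ c φ(t)` on the line through `t` is
dominated by the sublinear `φ`, and a dominated linear extension is represented by a dual feasible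
vector. -/
theorem exists_mem_dualPolyhedron_inner_eq (h1 : CompleteRecourse W)
    (h2 : SufficientlyExpensive W q) (t : EuclideanSpace ℝ (Fin s)) :
    ∃ v ∈ dualPolyhedron W q, ⟪v, t⟫_ℝ = recourseValue W q t := by
  have h0 : recourseValue W q (0 : EuclideanSpace ℝ (Fin s)) = 0 := by
    have := recourseValue_smul h1 h2 (two_pos) (0 : EuclideanSpace ℝ (Fin s))
    rw [smul_zero] at this
    linarith
  rcases eq_or_ne t 0 with rfl | ht
  · obtain ⟨v, hv⟩ := dualPolyhedron_nonempty h2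
    exact ⟨v, hv, by rw [inner_zero_right, h0]⟩
  obtain ⟨g, hg, hgle⟩ := exists_extension_of_le_sublinear
    (LinearPMap.mkSpanSingleton t (recourseValue W q t) ht) (recourseValue W q)
    (fun c hc x => recourseValue_smul h1 h2 hc x) (recourseValue_add_le h1 h2) (by
      rintro ⟨x, hx⟩
      obtain ⟨c, rfl⟩ := Submodule.mem_span_singleton.1 hx
      have : (LinearPMap.mkSpanSingleton t (recourseValue W q t) ht) ⟨c • t, hx⟩
          = c • recourseValue W q t := LinearPMap.mkSpanSingleton'_apply _ _ _ _ _
      rw [this, smul_eq_mul]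
      rcases lt_trichotomy c 0 with hc | rfl | hc
      -- For negative `c`, domination follows from `0 = φ(0) ≤ φ(c • t) + φ(-c • t)`.
      · have ha := recourseValue_smul h1 h2 (neg_pos.2 hc) t
        have hb := recourseValue_add_le h1 h2 (c • t) ((-c) • t)
        rw [← add_smul, add_neg_cancel, zero_smul, h0] at hb
        change _ ≤ recourseValue W q (c • t)
        linarith
      · simp [h0]
      · exact (recourseValue_smul h1 h2 hc t).ge)
  refine ⟨(InnerProductSpace.toDual ℝ _).symm (LinearMap.toContinuousLinearMap g), fun j => ?_, ?_⟩
  -- The `j`-th dual constraint is `g ≤ φ` tested at the `j`-th column of `W`, where `φ` costs at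
  -- most `q j`.
  · have hle := (hgle (WithLp.toLp 2 (W.mulVec (Pi.single j 1)))).trans
      (recourseValue_le h2 (y := Pi.single j 1) (by simp) rfl)
    set v := (InnerProductSpace.toDual ℝ (EuclideanSpace ℝ (Fin s))).symm
      (LinearMap.toContinuousLinearMap g) with hv
    have : ⟪v, WithLp.toLp 2 (W.mulVec (Pi.single j 1))⟫_ℝ
        = g (WithLp.toLp 2 (W.mulVec (Pi.single j 1))) := by
      rw [hv, InnerProductSpace.toDual_symm_apply]; rfl
    rw [← this, inner_mulVec_eq v _ (Pi.single j 1) rfl] at hle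
    simpa using hle
  · rw [InnerProductSpace.toDual_symm_apply]
    have := hg ⟨t, Submodule.mem_span_singleton_self t⟩
    rw [LinearPMap.mkSpanSingleton_apply] at this
    exact this

theorem isClosed_dualPolyhedron : IsClosed (dualPolyhedron W q) := by
  simp only [dualPolyhedron, Set.ofPred_forall]
  refine isClosed_iInter fun j => isClosed_le ?_ continuous_const
  simp only [Matrix.mulVec, dotProduct]
  fun_prop

theorem convex_dualPolyhedron : Convex ℝ (dualPolyhedron W q) := by
  intro v hv w hw a b ha hb hab j
  have : W.transpose.mulVec (a • v + b • w).ofLp j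
      = a * W.transpose.mulVec v.ofLp j + b * W.transpose.mulVec w.ofLp j := by
    simp [Matrix.mulVec_add, Matrix.mulVec_smul]
  rw [this]
  calc _ ≤ a * q j + b * q j :=
        add_le_add (mul_le_mul_of_nonneg_left (hv j) ha) (mul_le_mul_of_nonneg_left (hw j) hb)
    _ = q j := by rw [← add_mul, hab, one_mul]

/-- Weak duality at the vectors `±e_i`, where complete recourse makes `φ` finite, confines each
coordinate to an interval. -/
theorem isCompact_dualPolyhedron (h1 : CompleteRecourse W) :
    IsCompact (dualPolyhedron W q) := by
  have hK : IsCompact (WithLp.toLp 2 '' (Set.univ.pi fun i : Fin s =>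
      Set.Icc (-recourseValue W q (-EuclideanSpace.single i (1 : ℝ)))
        (recourseValue W q (EuclideanSpace.single i (1 : ℝ)))) :
        Set (EuclideanSpace ℝ (Fin s))) :=
    (isCompact_univ_pi fun i => isCompact_Icc).image (PiLp.continuous_toLp 2 _)
  refine hK.of_isClosed_subset isClosed_dualPolyhedron fun v hv => ⟨v.ofLp, fun i _ => ?_, rfl⟩
  have ha := inner_le_recourseValue h1 hv (EuclideanSpace.single i (1 : ℝ))
  have hb := inner_le_recourseValue h1 hv (-EuclideanSpace.single i (1 : ℝ))
  rw [inner_neg_right] at hb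
  simp only [EuclideanSpace.inner_single_right, conj_trivial, one_mul] at ha hb
  exact ⟨by linarith, ha⟩

/-- The recourse value is attained at a vertex of the dual polyhedron. -/
theorem exists_dualVertex_inner_eq (h1 : CompleteRecourse W) (h2 : SufficientlyExpensive W q)
    (t : EuclideanSpace ℝ (Fin s)) :
    ∃ d ∈ dualVertices W q, ⟪d, t⟫_ℝ = recourseValue W q t := by
  obtain ⟨v, hv, hvt⟩ := exists_mem_dualPolyhedron_inner_eq h1 h2 t
  obtain ⟨d, hd, hmax⟩ := exists_extremePoint_forall_inner_le (isCompact_dualPolyhedron h1)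
    (dualPolyhedron_nonempty h2) t
  refine ⟨d, hd, le_antisymm (inner_le_recourseValue h1 hd.1 t) ?_⟩
  rw [← hvt, real_inner_comm, real_inner_comm t d]
  exact hmax v hv

/-- A vertex is determined by its set of active constraints: if `v` and `w` have the same set, then
`v ± e(w - v)` stays feasible for small `e`, since inactive constraints have slack, and extremality
of `v` gives `w = v`. -/
theorem finite_dualVertices : (dualVertices W q).Finite := by
  classical
  refine Set.Finite.of_finite_image (f := fun v : EuclideanSpace ℝ (Fin s) =>
    {j | W.transpose.mulVec v.ofLp j = q j}) (Set.toFinite _) ?_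
  intro v hv w hw hvw
  have hlin : ∀ (e : ℝ) j, W.transpose.mulVec (v + e • (w - v)).ofLp j
      = W.transpose.mulVec v.ofLp j
        + e * (W.transpose.mulVec w.ofLp j - W.transpose.mulVec v.ofLp j) := by
    intro e j
    simp [Matrix.mulVec_add, Matrix.mulVec_smul, Matrix.mulVec_sub]
  have hev : ∀ᶠ e in nhds (0 : ℝ), v + e • (w - v) ∈ dualPolyhedron W q := by
    simp only [dualPolyhedron, Set.mem_ofPred_eq, hlin]
    refine Filter.eventually_all.2 fun j => ?_
    by_cases hj : W.transpose.mulVec v.ofLp j = q j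
    · have hwj : W.transpose.mulVec w.ofLp j = q j :=
        (Set.ext_iff.1 hvw j).1 hj
      exact Filter.Eventually.of_forall fun e => by simp [hj, hwj]
    · have hlt : W.transpose.mulVec v.ofLp j < q j := lt_of_le_of_ne (hv.1 j) hj
      have hc : Continuous fun e : ℝ => W.transpose.mulVec v.ofLp j
        + e * (W.transpose.mulVec w.ofLp j - W.transpose.mulVec v.ofLp j) := by fun_prop
      exact (hc.tendsto 0).eventually_le_const (by simpa using hlt)
  obtain ⟨ε, hε, hball⟩ := Metric.eventually_nhds_iff.1 hev
  have hp : v + (ε / 2) • (w - v) ∈ dualPolyhedron W q := hball (by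
    rw [Real.dist_eq, sub_zero, abs_of_pos (half_pos hε)]; linarith)
  have hm : v + (-(ε / 2)) • (w - v) ∈ dualPolyhedron W q := hball (by
    rw [Real.dist_eq, sub_zero, abs_neg, abs_of_pos (half_pos hε)]; linarith)
  have := hv.2 hp hm ⟨1 / 2, 1 / 2, by norm_num, by norm_num, by norm_num, by module⟩
  have h3 : (ε / 2) • (w - v) = 0 := by simpa using this
  rcases smul_eq_zero.1 h3 with h | h
  · linarith
  · exact (sub_eq_zero.1 h).symm

/-- The dual polyhedron contains a closed ball of positive radius. -/
theorem exists_closedBall_subset_dualPolyhedron (h2 : SufficientlyExpensive W q) :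
    ∃ (v : EuclideanSpace ℝ (Fin s)) (σ : ℝ), 0 < σ ∧
      Metric.closedBall v σ ⊆ dualPolyhedron W q := by
  obtain ⟨v, hv⟩ := h2
  have : ∀ᶠ w in nhds (WithLp.toLp 2 v : EuclideanSpace ℝ (Fin s)), w ∈ dualPolyhedron W q := by
    refine Filter.eventually_all.2 fun j => ?_
    have hc : Continuous fun w : EuclideanSpace ℝ (Fin s) => W.transpose.mulVec w.ofLp j := by
      simp only [Matrix.mulVec, dotProduct]
      fun_prop
    exact (hc.tendsto _).eventually_le_const (hv j)
  obtain ⟨ε, hε, h⟩ := Metric.nhds_basis_closedBall.mem_iff.1 this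
  exact ⟨_, ε, hε, h⟩

/-- The recourse function is Lipschitz. -/
theorem exists_recourseValue_sub_le (h1 : CompleteRecourse W) (h2 : SufficientlyExpensive W q) :
    ∃ M : ℝ, 0 < M ∧ (∀ v ∈ dualPolyhedron W q, ‖v‖ ≤ M) ∧
      ∀ t t' : EuclideanSpace ℝ (Fin s),
        |recourseValue W q t - recourseValue W q t'| ≤ M * ‖t - t'‖ := by
  obtain ⟨M, hM0, hM⟩ := (isCompact_dualPolyhedron (q := q) h1).isBounded.exists_pos_norm_le
  have key : ∀ t t' : EuclideanSpace ℝ (Fin s),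
      recourseValue W q t - recourseValue W q t' ≤ M * ‖t - t'‖ := by
    intro t t'
    obtain ⟨v, hv, hvt⟩ := exists_mem_dualPolyhedron_inner_eq h1 h2 t
    have := inner_le_recourseValue h1 hv t'
    calc _ ≤ ⟪v, t - t'⟫_ℝ := by rw [inner_sub_right]; linarith
      _ ≤ ‖v‖ * ‖t - t'‖ := real_inner_le_norm _ _
      _ ≤ _ := mul_le_mul_of_nonneg_right (hM v hv) (norm_nonneg _)
  refine ⟨M, hM0, hM, fun t t' => abs_le.2 ⟨?_, key t t'⟩⟩
  have := key t' t
  rw [norm_sub_rev] at this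
  linarith

theorem recourseValue_zero (h1 : CompleteRecourse W) (h2 : SufficientlyExpensive W q) :
    recourseValue W q (0 : EuclideanSpace ℝ (Fin s)) = 0 := by
  obtain ⟨v, -, hv⟩ := exists_mem_dualPolyhedron_inner_eq h1 h2 0
  rw [← hv, inner_zero_right]

theorem continuous_recourseValue (h1 : CompleteRecourse W) (h2 : SufficientlyExpensive W q) :
    Continuous (recourseValue W q) := by
  obtain ⟨M, hM, -, hlip⟩ := exists_recourseValue_sub_le h1 h2
  exact (LipschitzWith.of_dist_le_mul (K := ⟨M, hM.le⟩) fun x y => by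
    rw [Real.dist_eq, dist_eq_norm]; exact hlip x y).continuous

theorem convexOn_recourseValue (h1 : CompleteRecourse W) (h2 : SufficientlyExpensive W q) :
    ConvexOn ℝ Set.univ (recourseValue W q) := by
  refine ⟨convex_univ, fun x _ y _ a b ha hb hab => ?_⟩
  obtain ⟨v, hv, hvt⟩ := exists_mem_dualPolyhedron_inner_eq h1 h2 (a • x + b • y)
  rw [← hvt, inner_add_right, inner_smul_right, inner_smul_right]
  exact add_le_add (mul_le_mul_of_nonneg_left (inner_le_recourseValue h1 hv x) ha)
    (mul_le_mul_of_nonneg_left (inner_le_recourseValue h1 hv y) hb)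

/-- The point `v + σ t/‖t‖` of the inscribed ball is dual feasible; testing it against `t` gives the
extra term `σ‖t‖`. -/
theorem exists_width_bound (h1 : CompleteRecourse W) (h2 : SufficientlyExpensive W q) :
    ∃ σ : ℝ, 0 < σ ∧ ∃ v ∈ dualPolyhedron W q, ∀ t : EuclideanSpace ℝ (Fin s),
      ⟪v, t⟫_ℝ + σ * ‖t‖ ≤ recourseValue W q t := by
  obtain ⟨v, σ, hσ, hball⟩ := exists_closedBall_subset_dualPolyhedron h2
  refine ⟨σ, hσ, v, hball (Metric.mem_closedBall_self hσ.le), fun t => ?_⟩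
  rcases eq_or_ne t 0 with rfl | ht
  · simp [recourseValue_zero h1 h2]
  have ht' : ‖t‖ ≠ 0 := norm_ne_zero_iff.2 ht
  have hmem : v + (σ * ‖t‖⁻¹) • t ∈ dualPolyhedron W q := hball (by
    rw [mem_closedBall_iff_norm, add_sub_cancel_left, norm_smul, Real.norm_eq_abs,
      abs_of_nonneg (by positivity)]
    field_simp; exact le_rfl)
  refine le_trans (le_of_eq ?_) (inner_le_recourseValue h1 hmem t)
  rw [inner_add_left, real_inner_smul_left, real_inner_self_eq_norm_sq]
  field_simp

theorem width_le (h1 : CompleteRecourse W) (h2 : SufficientlyExpensive W q) :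
    ∃ σ : ℝ, 0 < σ ∧ ∀ t : EuclideanSpace ℝ (Fin s),
      2 * σ * ‖t‖ ≤ recourseValue W q t + recourseValue W q (-t) := by
  obtain ⟨σ, hσ, v, -, h⟩ := exists_width_bound h1 h2
  refine ⟨σ, hσ, fun t => ?_⟩
  have ha := h t
  have hb := h (-t)
  rw [inner_neg_right, norm_neg] at hb
  linarith

end Duality

/-! ### Linearity cones, extreme rays and the meaning of the slope constant `δ`. -/

section Cones

open scoped InnerProductSpace

variable {s m : ℕ} {W : Matrix (Fin s) (Fin m) ℝ} {q : Fin m → ℝ}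

theorem isClosed_linCone (d : EuclideanSpace ℝ (Fin s)) : IsClosed (linCone W q d) := by
  simp only [linCone, Set.ofPred_forall]
  exact isClosed_biInter fun d' _ => isClosed_le continuous_const
    (continuous_const.inner continuous_id)

theorem add_mem_linCone {d x y : EuclideanSpace ℝ (Fin s)} (hx : x ∈ linCone W q d)
    (hy : y ∈ linCone W q d) : x + y ∈ linCone W q d := fun d' hd' => by
  rw [inner_add_right]; exact add_nonneg (hx d' hd') (hy d' hd')

theorem smul_mem_linCone {d x : EuclideanSpace ℝ (Fin s)} (hx : x ∈ linCone W q d) {c : ℝ}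
    (hc : 0 ≤ c) : c • x ∈ linCone W q d := fun d' hd' => by
  rw [inner_smul_right]; exact mul_nonneg hc (hx d' hd')

theorem add_smul_mem_interior_linCone {d x w : EuclideanSpace ℝ (Fin s)}
    (hx : x ∈ linCone W q d) (hw : w ∈ interior (linCone W q d)) {c : ℝ} (hc : 0 < c) :
    x + c • w ∈ interior (linCone W q d) := by
  have hsub : (fun y => x + c • y) '' interior (linCone W q d) ⊆ linCone W q d := by
    rintro _ ⟨y, hy, rfl⟩
    exact add_mem_linCone hx (smul_mem_linCone (interior_subset hy) hc.le)
  have hopen : IsOpen ((fun y => x + c • y) '' interior (linCone W q d)) :=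
    ((isOpenMap_add_left x).comp (isOpenMap_smul₀ hc.ne')) _ isOpen_interior
  exact interior_maximal hsub hopen ⟨w, hw, rfl⟩

theorem mem_linCone_iff (h1 : CompleteRecourse W) (h2 : SufficientlyExpensive W q)
    {d : EuclideanSpace ℝ (Fin s)} (hd : d ∈ dualVertices W q) (z : EuclideanSpace ℝ (Fin s)) :
    z ∈ linCone W q d ↔ ⟪d, z⟫_ℝ = recourseValue W q z := by
  constructor
  · intro hz
    obtain ⟨d', hd', h⟩ := exists_dualVertex_inner_eq h1 h2 z
    have := hz d' hd'
    rw [inner_sub_left] at this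
    exact le_antisymm (inner_le_recourseValue h1 hd.1 z) (by linarith)
  · intro h d' hd'
    rw [inner_sub_left, h]
    linarith [inner_le_recourseValue h1 hd'.1 z]

/-- The vertices with full-dimensional linearity cone suffice to represent the recourse value. -/
theorem exists_full_dualVertex_inner_eq (h1 : CompleteRecourse W)
    (h2 : SufficientlyExpensive W q) (t : EuclideanSpace ℝ (Fin s)) :
    ∃ d ∈ dualVertices W q, (interior (linCone W q d)).Nonempty ∧
      ⟪d, t⟫_ℝ = recourseValue W q t := by
  have : Finite (dualVertices W q) := finite_dualVertices
  -- Baire: finitely many closed cones cover the space, so their interiors have dense union, and the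
  -- closure of a finite union is the union of the closures.
  have hcov : ⋃ d : dualVertices W q, linCone W q (d : EuclideanSpace ℝ (Fin s)) = Set.univ := by
    refine Set.eq_univ_of_forall fun z => ?_
    obtain ⟨d, hd, h⟩ := exists_dualVertex_inner_eq h1 h2 z
    exact Set.mem_iUnion.2 ⟨⟨d, hd⟩, (mem_linCone_iff h1 h2 hd z).2 h⟩
  have hdense := dense_iUnion_interior_of_closed
    (fun d : dualVertices W q => isClosed_linCone (W := W) (q := q) d) hcov
  have hmem : t ∈ closure (⋃ d : dualVertices W q,
      interior (linCone W q (d : EuclideanSpace ℝ (Fin s)))) := hdense t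
  rw [closure_iUnion_of_finite] at hmem
  obtain ⟨d, hd⟩ := Set.mem_iUnion.1 hmem
  refine ⟨d, d.2, closure_nonempty_iff.1 ⟨t, hd⟩, (mem_linCone_iff h1 h2 d.2 t).1 ?_⟩
  exact (isClosed_linCone _).closure_subset (closure_mono interior_subset hd)

/-- A small step from `t` towards an interior direction enters the interior of the cone while `d`
stays positive. -/
theorem mem_indexPos_of_inner_pos {d t : EuclideanSpace ℝ (Fin s)} (hd : d ∈ dualVertices W q)
    (hint : (interior (linCone W q d)).Nonempty) (ht : t ∈ linCone W q d) (hpos : 0 < ⟪d, t⟫_ℝ) :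
    d ∈ indexPos W q := by
  obtain ⟨w, hw⟩ := hint
  have hc : Continuous fun e : ℝ => ⟪d, t + e • w⟫_ℝ := by fun_prop
  have hev := (hc.tendsto 0).eventually_const_lt (show 0 < ⟪d, t + (0 : ℝ) • w⟫_ℝ by simpa)
  obtain ⟨ε, hε, hball⟩ := Metric.eventually_nhds_iff.1 hev
  have h := hball (y := ε / 2) (by
    rw [Real.dist_eq, sub_zero, abs_of_pos (half_pos hε)]; linarith)
  refine ⟨hd, ⟨t + (ε / 2) • w, ?_⟩, ?_⟩
  · have hopen : IsOpen {z : EuclideanSpace ℝ (Fin s) | 0 < ⟪d, z⟫_ℝ} :=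
      isOpen_lt continuous_const (continuous_const.inner continuous_id)
    refine mem_interior.2 ⟨interior (linCone W q d) ∩ {z | 0 < ⟪d, z⟫_ℝ},
      fun z hz => ⟨interior_subset hz.1, show 0 ≤ ⟪d, z⟫_ℝ from
        (show 0 < ⟪d, z⟫_ℝ from hz.2).le⟩, isOpen_interior.inter hopen,
      add_smul_mem_interior_linCone ht hw (half_pos hε), h⟩
  · rintro rfl
    simp at hpos

theorem exists_indexPos_inner_eq (h1 : CompleteRecourse W) (h2 : SufficientlyExpensive W q)
    {t : EuclideanSpace ℝ (Fin s)} (ht : 0 < recourseValue W q t) :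
    ∃ d ∈ indexPos W q, ⟪d, t⟫_ℝ = recourseValue W q t := by
  obtain ⟨d, hd, hint, h⟩ := exists_full_dualVertex_inner_eq h1 h2 t
  exact ⟨d, mem_indexPos_of_inner_pos hd hint ((mem_linCone_iff h1 h2 hd t).2 h) (h ▸ ht), h⟩

/-- Moving an interior point of `K_i⁺` slightly in the direction of `d` itself makes the inner
product strictly positive, as `d ≠ 0`. -/
theorem exists_interior_inner_pos {d : EuclideanSpace ℝ (Fin s)} (hd : d ∈ indexPos W q) :
    ∃ w ∈ interior (linCone W q d), 0 < ⟪d, w⟫_ℝ := by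
  obtain ⟨w, hw⟩ := hd.2.1
  have hc : Continuous fun e : ℝ => w + e • d := by fun_prop
  have hev : ∀ᶠ e in nhds (0 : ℝ), w + e • d ∈ interior (linConePos W q d) :=
    hc.continuousAt.eventually_mem (by simpa using isOpen_interior.mem_nhds hw)
  obtain ⟨ε, hε, hball⟩ := Metric.eventually_nhds_iff.1 hev
  have h := hball (y := ε / 2) (by
    rw [Real.dist_eq, sub_zero, abs_of_pos (half_pos hε)]; linarith)
  refine ⟨_, interior_mono Set.inter_subset_left h, ?_⟩
  rw [inner_add_right, inner_smul_right, real_inner_self_eq_norm_sq]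
  have h0 : 0 ≤ ⟪d, w⟫_ℝ := (interior_subset hw).2
  have : 0 < ‖d‖ := norm_pos_iff.2 hd.2.2
  positivity

/-- If `φ ≤ 0` has empty interior, then every full-dimensional cone has its index in `I⁺`. -/
theorem mem_indexPos_of_interior_eq_empty (h1 : CompleteRecourse W)
    (h2 : SufficientlyExpensive W q)
    (h : interior {t : EuclideanSpace ℝ (Fin s) | recourseValue W q t ≤ 0} = ∅)
    {d : EuclideanSpace ℝ (Fin s)} (hd : d ∈ dualVertices W q)
    (hint : (interior (linCone W q d)).Nonempty) : d ∈ indexPos W q := by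
  obtain ⟨w, hw, hpos⟩ : ∃ w ∈ interior (linCone W q d), 0 < recourseValue W q w := by
    by_contra! hcon
    obtain ⟨w, hw⟩ := hint
    have := interior_maximal (s := {t | recourseValue W q t ≤ 0}) hcon isOpen_interior hw
    rw [h] at this
    exact this
  have hwK := interior_subset hw
  exact mem_indexPos_of_inner_pos hd hint hwK (((mem_linCone_iff h1 h2 hd w).1 hwK).symm ▸ hpos)

theorem isExtremeRay_smul {d t : EuclideanSpace ℝ (Fin s)} (ht : IsExtremeRay (linCone W q d) t)
    {c : ℝ} (hc : 0 < c) : IsExtremeRay (linCone W q d) (c • t) := by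
  refine ⟨smul_mem_linCone ht.1 hc.le, smul_ne_zero hc.ne' ht.2.1, fun a ha b hb hab => ?_⟩
  obtain ⟨e, he, h⟩ := ht.2.2 (c⁻¹ • a) (smul_mem_linCone ha (inv_nonneg.2 hc.le)) (c⁻¹ • b)
    (smul_mem_linCone hb (inv_nonneg.2 hc.le))
    (by rw [← smul_add, hab, smul_smul, inv_mul_cancel₀ hc.ne', one_smul])
  refine ⟨e, he, ?_⟩
  rw [smul_comm e c t, ← h, smul_smul, mul_inv_cancel₀ hc.ne', one_smul]

/-- A point of the section is determined by its active cone constraints: if `y'` has the same ones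
as `y`, then `y - e • y'` remains in the cone for small `e`, extremality makes `y'` a multiple of
`y`, and the common value `η ≠ 0` of `d` makes them equal. -/
theorem finite_raySection (d : EuclideanSpace ℝ (Fin s)) {η : ℝ} (hη : 0 < η) :
    (raySection W q d η).Finite := by
  have hfin : Finite (dualVertices W q) := finite_dualVertices
  refine Set.Finite.of_finite_image (f := fun y : EuclideanSpace ℝ (Fin s) =>
    {d' : dualVertices W q | ⟪d - d', y⟫_ℝ = 0}) (Set.toFinite _) ?_
  intro y hy y' hy' hyy'
  have hev : ∀ᶠ e in nhds (0 : ℝ), ∀ d' : dualVertices W q, 0 ≤ ⟪d - d', y - e • y'⟫_ℝ := by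
    refine Filter.eventually_all.2 fun d' => ?_
    by_cases h : ⟪d - d', y⟫_ℝ = 0
    · have h' : ⟪d - d', y'⟫_ℝ = 0 := (Set.ext_iff.1 hyy' d').1 h
      exact Filter.Eventually.of_forall fun e => by
        rw [inner_sub_right, inner_smul_right, h, h']; simp
    · have hlt : 0 < ⟪d - d', y⟫_ℝ := lt_of_le_of_ne (hy.1.1 d' d'.2) (Ne.symm h)
      have hc : Continuous fun e : ℝ => ⟪d - d', y - e • y'⟫_ℝ := by fun_prop
      exact (hc.tendsto 0).eventually_const_le (by simpa using hlt)
  obtain ⟨ε, hε, hball⟩ := Metric.eventually_nhds_iff.1 hev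
  have h := hball (y := ε / 2) (by
    rw [Real.dist_eq, sub_zero, abs_of_pos (half_pos hε)]; linarith)
  obtain ⟨c, -, hc⟩ := hy.1.2.2 ((ε / 2) • y') (smul_mem_linCone hy'.1.1 (half_pos hε).le)
    (y - (ε / 2) • y') (fun d' hd' => h ⟨d', hd'⟩) (by abel)
  have hin := congrArg (fun z => ⟪d, z⟫_ℝ) hc
  simp only [inner_smul_right, hy.2, hy'.2] at hin
  have hce : ε / 2 = c := mul_right_cancel₀ hη.ne' hin
  rw [← hce] at hc
  exact (smul_right_injective _ (half_pos hε).ne' hc).symm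

/-- For `v` the centre of a ball in the dual polyhedron, `d - v` is at least `σ‖z‖` on `K_d`, so its
level set `1` is a compact base of the cone. An extreme point of the base maximizing `d` spans the
required ray. -/
theorem exists_isExtremeRay_inner_pos (h1 : CompleteRecourse W) (h2 : SufficientlyExpensive W q)
    {d : EuclideanSpace ℝ (Fin s)} (hd : d ∈ indexPos W q) :
    ∃ t, IsExtremeRay (linCone W q d) t ∧ 0 < ⟪d, t⟫_ℝ := by
  obtain ⟨σ, hσ, v, hv, hwidth⟩ := exists_width_bound h1 h2
  obtain ⟨w, hw, hwpos⟩ := exists_interior_inner_pos hd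
  have hb : ∀ z ∈ linCone W q d, σ * ‖z‖ ≤ ⟪d - v, z⟫_ℝ := fun z hz => by
    rw [inner_sub_left, (mem_linCone_iff h1 h2 hd.1 z).1 hz]
    linarith [hwidth z]
  set B : Set (EuclideanSpace ℝ (Fin s)) := {z ∈ linCone W q d | ⟪d - v, z⟫_ℝ = 1} with hB
  have hBclosed : IsClosed B := (isClosed_linCone d).inter
    (isClosed_eq (continuous_const.inner continuous_id) continuous_const)
  have hBcomp : IsCompact B := by
    refine Metric.isCompact_of_isClosed_isBounded hBclosed
      ((Metric.isBounded_closedBall (x := 0) (r := 1 / σ)).subset fun z hz => ?_)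
    have := hb z hz.1
    rw [hz.2] at this
    rwa [mem_closedBall_zero_iff, le_div_iff₀' hσ]
  have hpos : ∀ z ∈ linCone W q d, z ≠ 0 → 0 < ⟪d - v, z⟫_ℝ := fun z hz h0 =>
    lt_of_lt_of_le (mul_pos hσ (norm_pos_iff.2 h0)) (hb z hz)
  have hscale : ∀ z ∈ linCone W q d, z ≠ 0 → (⟪d - v, z⟫_ℝ)⁻¹ • z ∈ B := fun z hz h0 =>
    ⟨smul_mem_linCone hz (inv_nonneg.2 (hpos z hz h0).le), by
      rw [inner_smul_right, inv_mul_cancel₀ (hpos z hz h0).ne']⟩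
  have hwK := interior_subset hw
  have hw0 : w ≠ 0 := by rintro rfl; simp at hwpos
  obtain ⟨t, ht, hmax⟩ := exists_extremePoint_forall_inner_le hBcomp ⟨_, hscale w hwK hw0⟩ d
  have ht0 : t ≠ 0 := by
    rintro rfl
    have := ht.1.2
    simp at this
  refine ⟨t, ⟨ht.1.1, ht0, fun a ha b hb' hab => ?_⟩, ?_⟩
  · rcases eq_or_ne a 0 with rfl | ha0
    · exact ⟨0, le_rfl, by simp⟩
    rcases eq_or_ne b 0 with rfl | hb0
    · exact ⟨1, zero_le_one, by simpa using hab⟩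
    have hsum : ⟪d - v, a⟫_ℝ + ⟪d - v, b⟫_ℝ = 1 := by rw [← inner_add_right, hab]; exact ht.1.2
    have hap := hpos a ha ha0
    have hbp := hpos b hb' hb0
    -- The base point `t` is the convex combination of the rescaled `a` and `b` with weights `⟪d -
    -- v, a⟫` and `⟪d - v, b⟫`, which sum to `1`.
    have := ht.2 (hscale a ha ha0) (hscale b hb' hb0)
      ⟨_, _, hap, hbp, hsum, by
        rw [smul_smul, smul_smul, mul_inv_cancel₀ hap.ne', mul_inv_cancel₀ hbp.ne', one_smul,
          one_smul, hab]⟩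
    refine ⟨⟪d - v, a⟫_ℝ, hap.le, ?_⟩
    rw [← this, smul_smul, mul_inv_cancel₀ hap.ne', one_smul]
  · refine lt_of_lt_of_le ?_ (hmax _ (hscale w hwK hw0))
    rw [inner_smul_right]
    exact mul_pos (inv_pos.2 (hpos w hwK hw0)) hwpos

theorem exists_isMinRayPoint (h1 : CompleteRecourse W) (h2 : SufficientlyExpensive W q)
    {d : EuclideanSpace ℝ (Fin s)} (hd : d ∈ indexPos W q) {η : ℝ} (hη : 0 < η) :
    ∃ y, IsMinRayPoint W q d η y := by
  obtain ⟨t, ht, hpos⟩ := exists_isExtremeRay_inner_pos h1 h2 hd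
  have hne : (raySection W q d η).Nonempty := ⟨(η / ⟪d, t⟫_ℝ) • t,
    isExtremeRay_smul ht (div_pos hη hpos), by
      rw [inner_smul_right, div_mul_cancel₀ _ hpos.ne']⟩
  obtain ⟨y, hy, hmin⟩ := Set.exists_min_image _ (fun y => ‖y‖) (finite_raySection d hη) hne
  exact ⟨y, hy, hmin⟩

/-- For each index of `I⁺`, the linearity cone contains a ball of positive radius inside the ball of
radius `ρ` on which the recourse value exceeds the threshold. -/
theorem exists_ball_above_threshold (h1 : CompleteRecourse W) (h2 : SufficientlyExpensive W q)
    {ρ η₀ : ℝ} (hη₀ : 0 < η₀) (h5 : ThresholdBound W q ρ η₀)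
    {d : EuclideanSpace ℝ (Fin s)} (hd : d ∈ indexPos W q) :
    ∃ t τ, 0 < τ ∧ Metric.ball t τ ⊆ Metric.ball 0 ρ ∧
      ∃ η₁, η₀ < η₁ ∧ ∀ z ∈ Metric.ball t τ, z ∈ linCone W q d ∧ η₁ < ⟪d, z⟫_ℝ := by
  -- The point `ŷ` lies in the ball by A5 but only on the boundary of the region; adding a small
  -- multiple of `w` makes all conditions strict.
  obtain ⟨y, hy⟩ := exists_isMinRayPoint h1 h2 hd hη₀
  have hyρ := h5 d hd y hy
  obtain ⟨w, hw, hwpos⟩ := exists_interior_inner_pos hd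
  have hc : Continuous fun e : ℝ => ‖y + e • w‖ := by fun_prop
  have hev := (hc.tendsto 0).eventually_lt_const (show ‖y + (0 : ℝ) • w‖ < ρ by simpa)
  obtain ⟨ε, hε, hball⟩ := Metric.eventually_nhds_iff.1 hev
  have h := hball (y := ε / 2) (by
    rw [Real.dist_eq, sub_zero, abs_of_pos (half_pos hε)]; linarith)
  have hgap := mul_pos (half_pos hε) hwpos
  have hopen : IsOpen (Metric.ball (0 : EuclideanSpace ℝ (Fin s)) ρ ∩
      (interior (linCone W q d) ∩ {z | η₀ + ε / 2 * ⟪d, w⟫_ℝ / 2 < ⟪d, z⟫_ℝ})) :=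
    Metric.isOpen_ball.inter (isOpen_interior.inter
      (isOpen_lt continuous_const (continuous_const.inner continuous_id)))
  obtain ⟨τ, hτ, hsub⟩ := Metric.isOpen_iff.1 hopen (y + (ε / 2) • w)
    ⟨mem_ball_zero_iff.2 h, add_smul_mem_interior_linCone hy.1.1.1 hw (half_pos hε), by
      change η₀ + ε / 2 * ⟪d, w⟫_ℝ / 2 < ⟪d, y + (ε / 2) • w⟫_ℝ
      rw [inner_add_right, hy.1.2, inner_smul_right]
      linarith⟩
  exact ⟨_, τ, hτ, fun z hz => (hsub hz).1, _, by linarith,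
    fun z hz => ⟨interior_subset (hsub hz).2.1, (hsub hz).2.2⟩⟩

/-- If all indices of `I⁺` agree on `u`, then `u` spans the extreme rays on which `φ > 0`. -/
theorem inner_extremeRay_of_forall_inner_eq (h1 : CompleteRecourse W)
    (h2 : SufficientlyExpensive W q) {u : EuclideanSpace ℝ (Fin s)}
    (hu : 0 < recourseValue W q u)
    (hall : ∀ d ∈ indexPos W q, ⟪d, u⟫_ℝ = recourseValue W q u)
    {d t : EuclideanSpace ℝ (Fin s)} (hd : d ∈ indexPos W q)
    (ht : IsExtremeRay (linCone W q d) t) (hpos : 0 < ⟪d, t⟫_ℝ) :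
    ⟪d, ‖t‖⁻¹ • t⟫_ℝ = recourseValue W q u / ‖u‖ := by
  have hdt := (mem_linCone_iff h1 h2 hd.1 t).1 ht.1
  have hc : Continuous fun e : ℝ => recourseValue W q (t + e • u) :=
    (continuous_recourseValue h1 h2).comp (by fun_prop)
  have hev := (hc.tendsto 0).eventually_const_lt
    (show 0 < recourseValue W q (t + (0 : ℝ) • u) by simpa [← hdt] using hpos)
  obtain ⟨ε, hε, hball⟩ := Metric.eventually_nhds_iff.1 hev
  -- Near `t` the value `φ` is positive, hence attained by some `d' ∈ I⁺`. Since `d'` and `d` agree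
  -- on `u` and `d` is maximal at `t`, `d` is maximal at `t + e • u` as well.
  have hmem : ∀ e : ℝ, |e| < ε → t + e • u ∈ linCone W q d := fun e he => by
    obtain ⟨d', hd', h⟩ := exists_indexPos_inner_eq h1 h2 (hball (y := e) (by
      rwa [Real.dist_eq, sub_zero]))
    refine (mem_linCone_iff h1 h2 hd.1 _).2
      (le_antisymm (inner_le_recourseValue h1 hd.1.1 _) ?_)
    rw [← h, inner_add_right, inner_add_right, inner_smul_right, inner_smul_right,
      hall d hd, hall d' hd', hdt]
    linarith [inner_le_recourseValue h1 hd'.1.1 t]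
  have hε2 : 0 < ε / 2 := half_pos hε
  have hp := hmem (ε / 2) (by rw [abs_of_pos hε2]; linarith)
  have hm := hmem (-(ε / 2)) (by rw [abs_neg, abs_of_pos hε2]; linarith)
  -- Now `t` is the midpoint of `t ± (ε/2) • u`, both in the cone, so extremality makes `u` parallel
  -- to `t`.
  obtain ⟨c, -, hc'⟩ := ht.2.2 _ (smul_mem_linCone hp (c := 1 / 2) (by norm_num)) _
    (smul_mem_linCone hm (c := 1 / 2) (by norm_num)) (by module)
  have hut : (ε / 2) • u = (2 * c - 1) • t := by
    have : (2 : ℝ) • ((1 / 2 : ℝ) • (t + (ε / 2) • u)) = (2 : ℝ) • (c • t) := by rw [hc']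
    rw [smul_smul, smul_smul] at this
    norm_num at this
    rw [sub_smul, one_smul, ← this]
    abel
  have hin := congrArg (fun z => ⟪d, z⟫_ℝ) hut
  simp only [inner_smul_right, hall d hd] at hin
  have hcpos : 0 < 2 * c - 1 := by
    by_contra! hneg
    have h3 := mul_nonpos_of_nonpos_of_nonneg hneg hpos.le
    have h4 := mul_pos hε2 hu
    linarith
  have hnorm := congrArg norm hut
  rw [norm_smul, norm_smul, Real.norm_eq_abs, Real.norm_eq_abs, abs_of_pos hε2,
    abs_of_pos hcpos] at hnorm
  have htn : 0 < ‖t‖ := norm_pos_iff.2 ht.2.1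
  have hun : 0 < ‖u‖ := norm_pos_iff.2 (by rintro rfl; simp [recourseValue_zero h1 h2] at hu)
  rw [inner_smul_right, eq_div_iff hun.ne', inv_mul_eq_div, div_mul_eq_mul_div,
    div_eq_iff htn.ne']
  refine mul_left_cancel₀ (mul_pos hε2 hcpos).ne' ?_
  linear_combination (⟪d, t⟫_ℝ * (2 * c - 1)) * hnorm - ((2 * c - 1) * ‖t‖) * hin

/-- If all indices of `I⁺` agree on `u`, then `δ ≤ φ(u) / ‖u‖`. -/
theorem slopeMax_le_of_forall_inner_eq (h1 : CompleteRecourse W)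
    (h2 : SufficientlyExpensive W q) {η₀ : ℝ} (hη₀ : 0 < η₀)
    {α' γ' : EuclideanSpace ℝ (Fin s) → ℝ} (hα' : IsLowerSlope W q η₀ α')
    (hγ' : IsCutSlope W q η₀ γ') {u : EuclideanSpace ℝ (Fin s)}
    (hu : 0 < recourseValue W q u)
    (hall : ∀ d ∈ indexPos W q, ⟪d, u⟫_ℝ = recourseValue W q u) :
    slopeMax W q η₀ α' γ' ≤ recourseValue W q u / ‖u‖ := by
  refine Real.sSup_le ?_ (div_nonneg hu.le (norm_nonneg _))
  rintro _ (⟨d, hd, rfl⟩ | ⟨d, hd, rfl⟩)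
  · have hun : 0 < ‖u‖ := norm_pos_iff.2 (by rintro rfl; simp [recourseValue_zero h1 h2] at hu)
    rw [le_div_iff₀ hun, ← hall d hd.1]
    exact (hα' d hd).2 u ((mem_linCone_iff h1 h2 hd.1.1 u).2 (hall d hd.1))
  · obtain ⟨y, hy⟩ := exists_isMinRayPoint h1 h2 hd.1 hη₀
    rw [← inner_extremeRay_of_forall_inner_eq h1 h2 hu hall hd.1 hy.1.1
      (hy.1.2.symm ▸ hη₀)]
    exact ((hγ' d hd).2 y hy).le

end Cones

/-! ### Second differences of a convex function that is linear near two points. -/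

section SecondDifference

open scoped InnerProductSpace

theorem intervalIntegral_eq_of_affine {f : ℝ → ℝ} {a b A B c : ℝ}
    (h : ∀ x ∈ Set.uIcc a b, f x = A + B * (x - c)) :
    ∫ x in a..b, f x = A * (b - a) + B * ((b - c) ^ 2 - (a - c) ^ 2) / 2 := by
  rw [intervalIntegral.integral_congr h,
    intervalIntegral.integral_add (Continuous.intervalIntegrable (by fun_prop) _ _)
      (Continuous.intervalIntegrable (by fun_prop) _ _),
    intervalIntegral.integral_const, intervalIntegral.integral_const_mul,
    intervalIntegral.integral_sub (Continuous.intervalIntegrable (by fun_prop) _ _)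
      (Continuous.intervalIntegrable (by fun_prop) _ _),
    intervalIntegral.integral_const, integral_id]
  simp only [smul_eq_mul]
  ring

/-- A lower bound for the integrated second difference of three sections of a convex function whose
outer sections are affine near the end points of the interval of integration. -/
theorem le_integral_secondDiff_of_affine_ends {f₀ f₁ f₂ : ℝ → ℝ} (hf₀ : Continuous f₀)
    (hf₁ : Continuous f₁) (hf₂ : Continuous f₂) {θ A B k A' B' k' : ℝ}
    (hconv : ∀ x, 2 * f₀ x ≤ f₁ (x - θ) + f₂ (x + θ))
    (h₁ : ∀ x, |x| ≤ |θ| → f₁ x = A + k + B * (x - 0))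
    (h₂ : ∀ x, |x| ≤ |θ| → f₂ x = A - k + B * (x - 0))
    (h₁' : ∀ x, |x - 1| ≤ |θ| → f₁ x = A' + k' + B' * (x - 1))
    (h₂' : ∀ x, |x - 1| ≤ |θ| → f₂ x = A' - k' + B' * (x - 1)) :
    2 * θ * (k' - k) - θ ^ 2 * (B' - B) ≤ ∫ x in (0 : ℝ)..1, (f₁ x + f₂ x - 2 * f₀ x) := by
  have i₀ := fun a b => hf₀.intervalIntegrable (μ := volume) a b
  have i₁ := fun a b => hf₁.intervalIntegrable (μ := volume) a b
  have i₂ := fun a b => hf₂.intervalIntegrable (μ := volume) a b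
  have hmono : ∫ x in (0 : ℝ)..1, 2 * f₀ x ≤ ∫ x in (0 : ℝ)..1, (f₁ (x - θ) + f₂ (x + θ)) :=
    intervalIntegral.integral_mono_on zero_le_one ((i₀ 0 1).const_mul 2)
      -- After a change of variables the shifts by `∓θ` only move the intervals of integration of
      -- `f₁` and `f₂`. The difference from `[0, 1]` consists of end pieces on which both are
      -- affine. The sign of `θ` is free because the integrals are oriented.
      (Continuous.intervalIntegrable (by fun_prop) _ _) fun x _ => hconv x
  rw [intervalIntegral.integral_add (Continuous.intervalIntegrable (by fun_prop) _ _)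
    (Continuous.intervalIntegrable (by fun_prop) _ _),
    intervalIntegral.integral_comp_sub_right f₁ θ,
    intervalIntegral.integral_comp_add_right f₂ θ] at hmono
  rw [intervalIntegral.integral_sub ((i₁ 0 1).add (i₂ 0 1)) ((i₀ 0 1).const_mul 2),
    intervalIntegral.integral_add (i₁ 0 1) (i₂ 0 1)]
  have e₁ := intervalIntegral.integral_add_adjacent_intervals (i₁ (0 - θ) 0) (i₁ 0 (1 - θ))
  have e₁' := intervalIntegral.integral_add_adjacent_intervals (i₁ 0 (1 - θ)) (i₁ (1 - θ) 1)
  have e₂ := intervalIntegral.integral_add_adjacent_intervals (i₂ 0 (0 + θ)) (i₂ (0 + θ) (1 + θ))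
  have e₂' := intervalIntegral.integral_add_adjacent_intervals (i₂ 0 1) (i₂ 1 (1 + θ))
  have a₁ : ∫ x in (0 - θ)..0, f₁ x = _ := intervalIntegral_eq_of_affine fun x hx => h₁ x (by
    have := Set.abs_sub_right_of_mem_uIcc hx
    simpa using this)
  have a₂ : ∫ x in (0 : ℝ)..(0 + θ), f₂ x = _ :=
    intervalIntegral_eq_of_affine fun x hx => h₂ x (by
      have := Set.abs_sub_left_of_mem_uIcc hx
      simpa using this)
  have a₁' : ∫ x in (1 - θ)..1, f₁ x = _ := intervalIntegral_eq_of_affine fun x hx => h₁' x (by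
    have := Set.abs_sub_right_of_mem_uIcc hx
    rw [abs_sub_comm]
    simpa using this)
  have a₂' : ∫ x in (1 : ℝ)..(1 + θ), f₂ x = _ :=
    intervalIntegral_eq_of_affine fun x hx => h₂' x (by
      have := Set.abs_sub_left_of_mem_uIcc hx
      simpa using this)
  rw [a₁] at e₁
  rw [a₁'] at e₁'
  rw [a₂] at e₂
  rw [a₂'] at e₂'
  linarith

variable {E : Type*} [NormedAddCommGroup E] [InnerProductSpace ℝ E]

/-- The second difference of `F` at `(t, η)` along the direction `ε • (-u, c)`. -/
def secondDiff (F : E → ℝ → ℝ) (η : ℝ) (u : E) (c ε : ℝ) (t : E) : ℝ :=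
  F (t - ε • u) (η + ε * c) + F (t + ε • u) (η - ε * c) - 2 * F t η

theorem two_mul_le_of_convexOn {F : E → ℝ → ℝ}
    (hF : ConvexOn ℝ Set.univ fun p : E × ℝ => F p.1 p.2) (t u : E) (η c : ℝ) :
    2 * F t η ≤ F (t - u) (η + c) + F (t + u) (η - c) := by
  have := hF.2 (Set.mem_univ (t - u, η + c)) (Set.mem_univ (t + u, η - c))
    (show (0 : ℝ) ≤ 1 / 2 by norm_num) (show (0 : ℝ) ≤ 1 / 2 by norm_num) (by norm_num)
  have e : (1 / 2 : ℝ) • (t - u, η + c) + (1 / 2 : ℝ) • (t + u, η - c) = (t, η) := by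
    ext
    · simp only [Prod.fst_add, Prod.smul_fst]; module
    · simp only [Prod.snd_add, Prod.smul_snd, smul_eq_mul]; ring
  rw [e] at this
  simp only [smul_eq_mul] at this
  linarith

theorem secondDiff_nonneg {F : E → ℝ → ℝ}
    (hF : ConvexOn ℝ Set.univ fun p : E × ℝ => F p.1 p.2) (η : ℝ) (u : E) (c ε : ℝ) (t : E) :
    0 ≤ secondDiff F η u c ε t :=
  sub_nonneg.2 (two_mul_le_of_convexOn hF t (ε • u) η (ε * c))

theorem continuous_secondDiff {F : E → ℝ → ℝ} (hF : Continuous fun p : E × ℝ => F p.1 p.2)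
    (η : ℝ) (u : E) (c ε : ℝ) : Continuous (secondDiff F η u c ε) := by
  have h1 : Continuous fun t : E => F (t - ε • u) (η + ε * c) :=
    hF.comp (f := fun t => (t - ε • u, η + ε * c)) (by fun_prop)
  have h2 : Continuous fun t : E => F (t + ε • u) (η - ε * c) :=
    hF.comp (f := fun t => (t + ε • u, η - ε * c)) (by fun_prop)
  have h3 : Continuous fun t : E => F t η := hF.comp (f := fun t => (t, η)) (by fun_prop)
  exact (h1.add h2).sub (continuous_const.mul h3)

/-- `F` coincides near `B_τ(t₀) × {η}` with the linear function of gradient `(v, b)`. -/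
def IsLinearNear (F : E → ℝ → ℝ) (η : ℝ) (t₀ : E) (τ : ℝ) (v : E) (b : ℝ) : Prop :=
  ∀ᶠ η' in nhds η, ∀ t ∈ Metric.ball t₀ τ, F t η' = ⟪v, t⟫_ℝ + b * η'

/-- Convexity is used along the tilted direction `ε • (u + θ • (t₁ - t₀))` instead of `ε • u`;
undoing the tilt along the segment leaves boundary terms that involve only the two linear pieces.
Linearity is needed for levels near `η` because the second difference evaluates `F` at `η ± ε c`. -/
theorem le_integral_segment_secondDiff {F : E → ℝ → ℝ}
    (hF : ConvexOn ℝ Set.univ fun p : E × ℝ => F p.1 p.2)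
    (hFc : Continuous fun p : E × ℝ => F p.1 p.2) {η τ : ℝ} (hτ : 0 < τ)
    {t₀ t₁ v₀ v₁ : E} {b₀ b₁ : ℝ} (h₀ : IsLinearNear F η t₀ τ v₀ b₀)
    (h₁ : IsLinearNear F η t₁ τ v₁ b₁) (u : E) (c θ : ℝ) :
    ∀ᶠ ε in nhdsWithin (0 : ℝ) (Set.Ioi 0), ∀ w ∈ Metric.ball t₀ (τ / 2),
      ε ^ 2 * (2 * θ * ((b₁ * c - ⟪v₁, u⟫_ℝ) - (b₀ * c - ⟪v₀, u⟫_ℝ))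
          - θ ^ 2 * ⟪v₁ - v₀, t₁ - t₀⟫_ℝ)
        ≤ ∫ x in (0 : ℝ)..1, secondDiff F η u c ε (w + x • (t₁ - t₀)) := by
  have hp : Filter.Tendsto (fun ε : ℝ => η + ε * c) (nhds 0) (nhds η) :=
    Continuous.tendsto' (by fun_prop) _ _ (by simp)
  have hm : Filter.Tendsto (fun ε : ℝ => η - ε * c) (nhds 0) (nhds η) :=
    Continuous.tendsto' (by fun_prop) _ _ (by simp)
  -- For `w` in the half-radius ball, this keeps every shifted end piece inside the balls of
  -- linearity.
  have hs : ∀ᶠ ε in nhds (0 : ℝ), |ε| * (|θ| * ‖t₁ - t₀‖ + ‖u‖) < τ / 2 := by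
    have hc : Continuous fun ε : ℝ => |ε| * (|θ| * ‖t₁ - t₀‖ + ‖u‖) := by fun_prop
    exact (hc.tendsto 0).eventually_lt_const (by simpa using half_pos hτ)
  filter_upwards [nhdsWithin_le_nhds (hp.eventually h₀), nhdsWithin_le_nhds (hp.eventually h₁),
    nhdsWithin_le_nhds (hm.eventually h₀), nhdsWithin_le_nhds (hm.eventually h₁),
    nhdsWithin_le_nhds hs] with ε hp₀ hp₁ hm₀ hm₁ hε w hw
  set e := t₁ - t₀ with he
  have hsmall : ∀ (x : ℝ) (z : E), |x| ≤ |θ * ε| → ‖z‖ ≤ |ε| * ‖u‖ →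
      ‖w + x • e + z - t₀‖ < τ := fun x z hx hz => by
    have h1 : ‖x • e‖ ≤ |ε| * (|θ| * ‖e‖) := by
      rw [norm_smul, Real.norm_eq_abs, ← mul_assoc, ← abs_mul, mul_comm ε]
      exact mul_le_mul_of_nonneg_right hx (norm_nonneg _)
    have h2 : ‖w - t₀‖ < τ / 2 := by rwa [← dist_eq_norm]
    calc ‖w + x • e + z - t₀‖ = ‖(w - t₀) + x • e + z‖ := by congr 1; abel
      _ ≤ ‖w - t₀‖ + ‖x • e‖ + ‖z‖ := norm_add₃_le
      _ < τ := by linarith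
  have hnu : ‖ε • u‖ ≤ |ε| * ‖u‖ := (norm_smul _ _).le
  have hnu' : ‖-(ε • u)‖ ≤ |ε| * ‖u‖ := by rw [norm_neg]; exact hnu
  have hball₀ : ∀ (x : ℝ) (z : E), |x| ≤ |θ * ε| → ‖z‖ ≤ |ε| * ‖u‖ →
      w + x • e + z ∈ Metric.ball t₀ τ := fun x z hx hz =>
    mem_ball_iff_norm.2 (hsmall x z hx hz)
  have hball₁ : ∀ (x : ℝ) (z : E), |x - 1| ≤ |θ * ε| → ‖z‖ ≤ |ε| * ‖u‖ →
      w + x • e + z ∈ Metric.ball t₁ τ := fun x z hx hz => by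
    have : w + x • e + z - t₁ = w + (x - 1) • e + z - t₀ := by rw [he]; module
    exact mem_ball_iff_norm.2 (this ▸ hsmall (x - 1) z hx hz)
  have hc₁ : Continuous fun x : ℝ => F (w + x • e - ε • u) (η + ε * c) :=
    hFc.comp (f := fun x : ℝ => (w + x • e - ε • u, η + ε * c)) (by fun_prop)
  have hc₂ : Continuous fun x : ℝ => F (w + x • e + ε • u) (η - ε * c) :=
    hFc.comp (f := fun x : ℝ => (w + x • e + ε • u, η - ε * c)) (by fun_prop)
  have hc₀ : Continuous fun x : ℝ => F (w + x • e) η :=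
    hFc.comp (f := fun x : ℝ => (w + x • e, η)) (by fun_prop)
  have key := le_integral_secondDiff_of_affine_ends hc₀ hc₁ hc₂ (θ := θ * ε)
    (A := ⟪v₀, w⟫_ℝ + b₀ * η) (k := ε * (b₀ * c - ⟪v₀, u⟫_ℝ)) (B := ⟪v₀, e⟫_ℝ)
    (A' := ⟪v₁, w + e⟫_ℝ + b₁ * η) (k' := ε * (b₁ * c - ⟪v₁, u⟫_ℝ)) (B' := ⟪v₁, e⟫_ℝ)
    (fun x => by
      have := two_mul_le_of_convexOn hF (w + x • e) ((θ * ε) • e + ε • u) η (ε * c)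
      have e1 : w + x • e - ((θ * ε) • e + ε • u) = w + (x - θ * ε) • e - ε • u := by module
      have e2 : w + x • e + ((θ * ε) • e + ε • u) = w + (x + θ * ε) • e + ε • u := by module
      rwa [e1, e2] at this)
    (fun x hx => by
      rw [sub_eq_add_neg (w + x • e), hp₀ _ (hball₀ x _ hx hnu'), inner_add_right,
        inner_add_right, inner_neg_right, inner_smul_right, inner_smul_right]
      ring)
    (fun x hx => by
      rw [hm₀ _ (hball₀ x _ hx hnu), inner_add_right,
        inner_add_right, inner_smul_right, inner_smul_right]
      ring)
    (fun x hx => by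
      rw [sub_eq_add_neg (w + x • e), hp₁ _ (hball₁ x _ hx hnu'), inner_add_right,
        inner_add_right, inner_neg_right, inner_smul_right, inner_smul_right, inner_add_right]
      ring)
    (fun x hx => by
      rw [hm₁ _ (hball₁ x _ hx hnu), inner_add_right,
        inner_add_right, inner_smul_right, inner_smul_right, inner_add_right]
      ring)
  refine le_trans (le_of_eq ?_) key
  rw [inner_sub_left]
  ring

variable [FiniteDimensional ℝ E] [MeasurableSpace E] [BorelSpace E]

/-- Fubini: for fixed `x` the segment points sweep out a translated ball, which lies in the large
ball by convexity. -/
theorem integral_segment_le_integral_ball {f : E → ℝ} (hf : Continuous f) (hf0 : ∀ t, 0 ≤ f t)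
    {t₀ t₁ : E} {τ ρ : ℝ} (hb₀ : Metric.ball t₀ τ ⊆ Metric.ball 0 ρ)
    (hb₁ : Metric.ball t₁ τ ⊆ Metric.ball 0 ρ) {κ : ℝ}
    (hκ : ∀ w ∈ Metric.ball t₀ τ, κ ≤ ∫ x in (0 : ℝ)..1, f (w + x • (t₁ - t₀))) :
    volume.real (Metric.ball t₀ τ) * κ ≤ ∫ t in Metric.ball (0 : E) ρ, f t := by
  have hfin : volume (Metric.ball t₀ τ) ≠ ⊤ := measure_ball_lt_top.ne
  have hint : IntegrableOn f (Metric.ball (0 : E) ρ) :=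
    (hf.continuousOn.integrableOn_compact (isCompact_closedBall 0 ρ)).mono_set
      Metric.ball_subset_closedBall
  have hg : Continuous fun p : E × ℝ => f (p.1 + p.2 • (t₁ - t₀)) := by fun_prop
  have hprod : Integrable (fun p : E × ℝ => f (p.1 + p.2 • (t₁ - t₀)))
      ((volume.restrict (Metric.ball t₀ τ)).prod (volume.restrict (Set.Ioc (0 : ℝ) 1))) := by
    rw [Measure.prod_restrict]
    exact (hg.continuousOn.integrableOn_compact
      ((isCompact_closedBall t₀ τ).prod (isCompact_Icc (a := (0 : ℝ)) (b := 1)))).mono_set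
      (Set.prod_mono Metric.ball_subset_closedBall Set.Ioc_subset_Icc_self)
  have hslice : ∀ x ∈ Set.Ioc (0 : ℝ) 1,
      ∫ w in Metric.ball t₀ τ, f (w + x • (t₁ - t₀)) ≤ ∫ t in Metric.ball (0 : E) ρ, f t := by
    intro x hx
    have hpre : (fun w => w + x • (t₁ - t₀)) ⁻¹' (Metric.ball (t₀ + x • (t₁ - t₀)) τ)
        = Metric.ball t₀ τ := by
      ext w
      simp
    have hsub : Metric.ball (t₀ + x • (t₁ - t₀)) τ ⊆ Metric.ball 0 ρ := by
      intro z hz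
      have hz0 : z - x • (t₁ - t₀) ∈ Metric.ball 0 ρ := hb₀ (by
        rw [mem_ball_iff_norm] at hz ⊢; rwa [sub_right_comm, sub_sub])
      have hz1 : z + (1 - x) • (t₁ - t₀) ∈ Metric.ball 0 ρ := hb₁ (by
        rw [mem_ball_iff_norm] at hz ⊢
        convert hz using 2
        module)
      have := (convex_ball (0 : E) ρ) hz0 hz1 (sub_nonneg.2 hx.2) hx.1.le (by ring)
      convert this using 1
      module
    rw [← hpre, (measurePreserving_add_right volume (x • (t₁ - t₀))).setIntegral_preimage_emb
      (measurableEmbedding_addRight _) f]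
    exact setIntegral_mono_set hint (Filter.Eventually.of_forall hf0) hsub.eventuallyLE
  calc volume.real (Metric.ball t₀ τ) * κ
      = ∫ _ in Metric.ball t₀ τ, κ := by rw [setIntegral_const, smul_eq_mul]
    _ ≤ ∫ w in Metric.ball t₀ τ, ∫ x in Set.Ioc (0 : ℝ) 1, f (w + x • (t₁ - t₀)) := by
        refine setIntegral_mono_on (integrableOn_const hfin) hprod.integral_prod_left
          measurableSet_ball fun w hw => ?_
        rw [← intervalIntegral.integral_of_le zero_le_one]
        exact hκ w hw
    _ = ∫ x in Set.Ioc (0 : ℝ) 1, ∫ w in Metric.ball t₀ τ, f (w + x • (t₁ - t₀)) :=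
        integral_integral_swap hprod
    _ ≤ ∫ _ in Set.Ioc (0 : ℝ) 1, ∫ t in Metric.ball (0 : E) ρ, f t :=
        setIntegral_mono_on hprod.integral_prod_right (integrableOn_const (by simp))
          measurableSet_Ioc hslice
    _ = ∫ t in Metric.ball (0 : E) ρ, f t := by simp

/-- A convex function which is linear with different derivatives in direction `(-u, c)` near two
points has an integrated second difference of quadratic order. -/
theorem le_integral_secondDiff_of_isLinearNear {F : E → ℝ → ℝ}
    (hF : ConvexOn ℝ Set.univ fun p : E × ℝ => F p.1 p.2)
    (hFc : Continuous fun p : E × ℝ => F p.1 p.2) {η τ ρ : ℝ} (hτ : 0 < τ)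
    {t₀ t₁ v₀ v₁ : E} {b₀ b₁ : ℝ} (h₀ : IsLinearNear F η t₀ τ v₀ b₀)
    (h₁ : IsLinearNear F η t₁ τ v₁ b₁) (hb₀ : Metric.ball t₀ τ ⊆ Metric.ball 0 ρ)
    (hb₁ : Metric.ball t₁ τ ⊆ Metric.ball 0 ρ) {B : ℝ} (hB : 0 < B)
    (hvB : ⟪v₁ - v₀, t₁ - t₀⟫_ℝ ≤ B) (u : E) (c : ℝ) :
    ∀ᶠ ε in nhdsWithin (0 : ℝ) (Set.Ioi 0),
      volume.real (Metric.ball (0 : E) (τ / 2)) / B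
          * ((b₁ * c - ⟪v₁, u⟫_ℝ) - (b₀ * c - ⟪v₀, u⟫_ℝ)) ^ 2 * ε ^ 2
        ≤ ∫ t in Metric.ball (0 : E) ρ, secondDiff F η u c ε t := by
  set K := (b₁ * c - ⟪v₁, u⟫_ℝ) - (b₀ * c - ⟪v₀, u⟫_ℝ) with hK
  -- The tilt `θ = K / B` maximizes `2θK - θ²B`, with value `K² / B`.
  filter_upwards [le_integral_segment_secondDiff hF hFc hτ h₀ h₁ u c (K / B)] with ε hε
  have hsub : ∀ t : E, Metric.ball t (τ / 2) ⊆ Metric.ball t τ := fun t =>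
    Metric.ball_subset_ball (by linarith)
  have := integral_segment_le_integral_ball (continuous_secondDiff hFc η u c ε)
    (secondDiff_nonneg hF η u c ε) ((hsub t₀).trans hb₀) ((hsub t₁).trans hb₁)
    (t₁ := t₁) hε
  refine le_trans ?_ this
  have hvol : volume.real (Metric.ball t₀ (τ / 2)) = volume.real (Metric.ball (0 : E) (τ / 2)) := by
    rw [measureReal_def, measureReal_def, Measure.addHaar_ball_center]
  rw [hvol, div_mul_eq_mul_div, div_mul_eq_mul_div, mul_assoc, mul_div_assoc]
  refine mul_le_mul_of_nonneg_left ?_ measureReal_nonneg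
  have h2 : K ^ 2 / B ≤ 2 * (K / B) * K - (K / B) ^ 2 * ⟪v₁ - v₀, t₁ - t₀⟫_ℝ := by
    have h3 : (K / B) ^ 2 * ⟪v₁ - v₀, t₁ - t₀⟫_ℝ ≤ (K / B) ^ 2 * B :=
      mul_le_mul_of_nonneg_left hvB (sq_nonneg _)
    have h4 : (K / B) ^ 2 * B = K ^ 2 / B := by field_simp
    have h5 : 2 * (K / B) * K = 2 * (K ^ 2 / B) := by ring
    linarith
  rw [mul_comm (K ^ 2), mul_div_assoc]
  exact mul_le_mul_of_nonneg_left h2 (sq_nonneg ε)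

end SecondDifference

/-! ### Second-difference bounds uniform in direction and level. -/

section UniformBounds

open scoped InnerProductSpace

/-- This yields one ball radius for all of the finitely many vertices, so that the final constant
does not depend on the vertex selected. -/
theorem exists_uniform_pos {α : Type*} {S : Set α} (hS : S.Finite) {P : α → ℝ → Prop}
    (hmono : ∀ a τ τ', P a τ → τ' ≤ τ → P a τ') (h : ∀ a ∈ S, ∃ τ, 0 < τ ∧ P a τ) :
    ∃ τ, 0 < τ ∧ ∀ a ∈ S, P a τ := by
  have hev : ∀ᶠ τ in nhdsWithin (0 : ℝ) (Set.Ioi 0), ∀ a ∈ S, P a τ := by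
    refine (Filter.eventually_all_finite hS).2 fun a ha => ?_
    obtain ⟨τ, hτ, hP⟩ := h a ha
    filter_upwards [Ioc_mem_nhdsGT hτ] with τ' hτ' using hmono a τ τ' hP hτ'.2
  obtain ⟨τ, hP, hτ⟩ := (hev.and self_mem_nhdsWithin).exists
  exact ⟨τ, hτ, hP⟩

section Pieces

variable {E : Type*} [NormedAddCommGroup E] [InnerProductSpace ℝ E]

theorem IsLinearNear.mono {F : E → ℝ → ℝ} {η : ℝ} {t v : E} {τ τ' b : ℝ}
    (h : IsLinearNear F η t τ v b) (hτ : τ' ≤ τ) : IsLinearNear F η t τ' v b :=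
  Filter.Eventually.mono h fun _ h' z hz => h' z (Metric.ball_subset_ball hτ hz)

/-- The bound `B = 4Mρ` on `⟪v₁ - v₀, t₁ - t₀⟫` depends only on the sizes of the gradients and the
ball. Thus `C` is uniform, while the admissible range of `ε` is not; the latter is harmless for the
strong convexity criterion. -/
theorem exists_const_le_integral_secondDiff [FiniteDimensional ℝ E] [MeasurableSpace E]
    [BorelSpace E] {τ ρ M : ℝ} (hτ : 0 < τ) (hρ : 0 < ρ) (hM : 0 < M) :
    ∃ C : ℝ, 0 < C ∧ ∀ F : E → ℝ → ℝ, ConvexOn ℝ Set.univ (fun p : E × ℝ => F p.1 p.2) →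
      Continuous (fun p : E × ℝ => F p.1 p.2) → ∀ (η : ℝ) (t₀ t₁ v₀ v₁ : E) (b₀ b₁ : ℝ),
      IsLinearNear F η t₀ τ v₀ b₀ → IsLinearNear F η t₁ τ v₁ b₁ →
      Metric.ball t₀ τ ⊆ Metric.ball 0 ρ → Metric.ball t₁ τ ⊆ Metric.ball 0 ρ →
      ‖v₀‖ ≤ M → ‖v₁‖ ≤ M → ∀ (u : E) (c : ℝ), ∀ᶠ ε in nhdsWithin (0 : ℝ) (Set.Ioi 0),
        C * ((b₁ * c - ⟪v₁, u⟫_ℝ) - (b₀ * c - ⟪v₀, u⟫_ℝ)) ^ 2 * ε ^ 2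
          ≤ ∫ t in Metric.ball (0 : E) ρ, secondDiff F η u c ε t := by
  refine ⟨volume.real (Metric.ball (0 : E) (τ / 2)) / (4 * M * ρ), ?_, ?_⟩
  · have : 0 < volume.real (Metric.ball (0 : E) (τ / 2)) :=
      ENNReal.toReal_pos (Metric.measure_ball_pos _ _ (half_pos hτ)).ne' measure_ball_lt_top.ne
    positivity
  · intro F hF hFc η t₀ t₁ v₀ v₁ b₀ b₁ h₀ h₁ hb₀ hb₁ hv₀ hv₁ u c
    refine le_integral_secondDiff_of_isLinearNear hF hFc hτ h₀ h₁ hb₀ hb₁ (by positivity) ?_ u c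
    have ht₀ := mem_ball_zero_iff.1 (hb₀ (Metric.mem_ball_self hτ))
    have ht₁ := mem_ball_zero_iff.1 (hb₁ (Metric.mem_ball_self hτ))
    have hv : ‖v₁ - v₀‖ ≤ 2 * M := (norm_sub_le _ _).trans (by linarith)
    have ht : ‖t₁ - t₀‖ ≤ 2 * ρ := (norm_sub_le _ _).trans (by linarith)
    calc ⟪v₁ - v₀, t₁ - t₀⟫_ℝ ≤ ‖v₁ - v₀‖ * ‖t₁ - t₀‖ := real_inner_le_norm _ _
      _ ≤ (2 * M) * (2 * ρ) := mul_le_mul hv ht (norm_nonneg _) (by positivity)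
      _ = 4 * M * ρ := by ring

end Pieces

variable {s m : ℕ} {W : Matrix (Fin s) (Fin m) ℝ} {q : Fin m → ℝ}

/-- The excess `max {0, φ(t) - η}`. -/
noncomputable def excess (W : Matrix (Fin s) (Fin m) ℝ) (q : Fin m → ℝ)
    (t : EuclideanSpace ℝ (Fin s)) (η : ℝ) : ℝ :=
  max 0 (recourseValue W q t - η)

theorem continuous_excess (h1 : CompleteRecourse W) (h2 : SufficientlyExpensive W q) :
    Continuous fun p : EuclideanSpace ℝ (Fin s) × ℝ => excess W q p.1 p.2 :=
  continuous_const.max (((continuous_recourseValue h1 h2).comp continuous_fst).sub continuous_snd)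

theorem convexOn_recourseValue_fst (h1 : CompleteRecourse W) (h2 : SufficientlyExpensive W q) :
    ConvexOn ℝ Set.univ fun p : EuclideanSpace ℝ (Fin s) × ℝ => recourseValue W q p.1 :=
  ⟨convex_univ, fun x _ y _ _ _ ha hb hab =>
    (convexOn_recourseValue h1 h2).2 (Set.mem_univ x.1) (Set.mem_univ y.1) ha hb hab⟩

theorem convexOn_excess (h1 : CompleteRecourse W) (h2 : SufficientlyExpensive W q) :
    ConvexOn ℝ Set.univ fun p : EuclideanSpace ℝ (Fin s) × ℝ => excess W q p.1 p.2 := by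
  have hsnd : ConcaveOn ℝ Set.univ fun p : EuclideanSpace ℝ (Fin s) × ℝ => p.2 :=
    (LinearMap.snd ℝ (EuclideanSpace ℝ (Fin s)) ℝ).concaveOn convex_univ
  exact (convexOn_const 0 convex_univ).sup ((convexOn_recourseValue_fst h1 h2).sub hsnd)

theorem isLinearNear_excess_of_gt (h1 : CompleteRecourse W) (h2 : SufficientlyExpensive W q)
    {d t : EuclideanSpace ℝ (Fin s)} (hd : d ∈ dualVertices W q) {τ η η₁ : ℝ} (hη : η < η₁)
    (h : ∀ z ∈ Metric.ball t τ, z ∈ linCone W q d ∧ η₁ < ⟪d, z⟫_ℝ) :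
    IsLinearNear (excess W q) η t τ d (-1) := by
  filter_upwards [Iio_mem_nhds hη] with η' (hη' : η' < η₁) z hz
  obtain ⟨hK, hgt⟩ := h z hz
  rw [mem_linCone_iff h1 h2 hd] at hK
  rw [excess, max_eq_right (by linarith), hK]
  ring

theorem isLinearNear_excess_of_le {t : EuclideanSpace ℝ (Fin s)} {τ η η₁ : ℝ} (hη : -η₁ < η)
    (h : ∀ z ∈ Metric.ball t τ, recourseValue W q z ≤ -η₁) :
    IsLinearNear (excess W q) η t τ 0 0 := by
  filter_upwards [Ioi_mem_nhds hη] with η' (hη' : -η₁ < η') z hz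
  rw [excess, max_eq_left (by linarith [h z hz]), inner_zero_left]
  ring

theorem isLinearNear_recourseValue (h1 : CompleteRecourse W) (h2 : SufficientlyExpensive W q)
    {d t : EuclideanSpace ℝ (Fin s)} (hd : d ∈ dualVertices W q) {τ : ℝ} (η : ℝ)
    (h : Metric.ball t τ ⊆ linCone W q d) :
    IsLinearNear (fun t _ => recourseValue W q t) η t τ d 0 :=
  Filter.Eventually.of_forall fun η' z hz => by
    rw [(mem_linCone_iff h1 h2 hd z).1 (h hz)]; ring

theorem exists_ball_subset_linCone {d : EuclideanSpace ℝ (Fin s)}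
    (hint : (interior (linCone W q d)).Nonempty) {ρ : ℝ} (hρ : 0 < ρ) :
    ∃ τ, 0 < τ ∧ ∃ t, Metric.ball t τ ⊆ Metric.ball 0 ρ ∧ Metric.ball t τ ⊆ linCone W q d := by
  obtain ⟨w, hw⟩ := hint
  have hc : Continuous fun e : ℝ => ‖e • w‖ := by fun_prop
  have hev := (hc.tendsto 0).eventually_lt_const (show ‖(0 : ℝ) • w‖ < ρ by simpa)
  obtain ⟨ε, hlt, hε⟩ := ((hev.filter_mono nhdsWithin_le_nhds).and
    (self_mem_nhdsWithin (s := Set.Ioi (0 : ℝ)))).exists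
  have hmem : ε • w ∈ interior (linCone W q d) := by
    have h0 : (0 : EuclideanSpace ℝ (Fin s)) ∈ linCone W q d := fun d' _ => by simp
    simpa using add_smul_mem_interior_linCone h0 hw hε
  obtain ⟨τ, hτ, hsub⟩ := Metric.isOpen_iff.1
    (Metric.isOpen_ball.inter isOpen_interior) (ε • w) ⟨mem_ball_zero_iff.2 hlt, hmem⟩
  exact ⟨τ, hτ, _, fun z hz => (hsub hz).1, fun z hz => interior_subset (hsub hz).2⟩

/-- The second difference of the recourse value is uniformly quadratic. -/
theorem exists_secondDiff_recourseValue_bound (h1 : CompleteRecourse W)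
    (h2 : SufficientlyExpensive W q) {ρ : ℝ} (hρ : 0 < ρ) :
    ∃ κ : ℝ, 0 < κ ∧ ∀ (η : ℝ) (u : EuclideanSpace ℝ (Fin s)) (c : ℝ),
      ∀ᶠ ε in nhdsWithin (0 : ℝ) (Set.Ioi 0), κ * ‖u‖ ^ 2 * ε ^ 2 ≤
        ∫ t in Metric.ball 0 ρ, secondDiff (fun t _ => recourseValue W q t) η u c ε t := by
  obtain ⟨σ, hσ, hwidth⟩ := width_le h1 h2
  obtain ⟨M, hM, hMD, -⟩ := exists_recourseValue_sub_le h1 h2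
  obtain ⟨τ, hτ, hball⟩ := exists_uniform_pos
    (S := {d ∈ dualVertices W q | (interior (linCone W q d)).Nonempty})
    (P := fun d τ => ∃ t, Metric.ball t τ ⊆ Metric.ball 0 ρ ∧ Metric.ball t τ ⊆ linCone W q d)
    (finite_dualVertices.subset (Set.sep_subset _ _))
    (fun d τ τ' ⟨t, ha, hb⟩ hle => ⟨t, (Metric.ball_subset_ball hle).trans ha,
      (Metric.ball_subset_ball hle).trans hb⟩)
    (fun d hd => exists_ball_subset_linCone hd.2 hρ)
  obtain ⟨C, hC, hbound⟩ := exists_const_le_integral_secondDiff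
    (E := EuclideanSpace ℝ (Fin s)) hτ hρ hM
  refine ⟨C * (2 * σ) ^ 2, by positivity, fun η u c => ?_⟩
  obtain ⟨d, hd, hdint, hdu⟩ := exists_full_dualVertex_inner_eq h1 h2 u
  obtain ⟨d', hd', hdint', hdu'⟩ := exists_full_dualVertex_inner_eq h1 h2 (-u)
  obtain ⟨t, hta, htb⟩ := hball d ⟨hd, hdint⟩
  obtain ⟨t', hta', htb'⟩ := hball d' ⟨hd', hdint'⟩
  filter_upwards [hbound _ (convexOn_recourseValue_fst h1 h2)
    ((continuous_recourseValue h1 h2).comp continuous_fst) η t t' d d' 0 0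
    (isLinearNear_recourseValue h1 h2 hd η htb) (isLinearNear_recourseValue h1 h2 hd' η htb')
    hta hta' (hMD d hd.1) (hMD d' hd'.1) u c] with ε hε
  refine le_trans ?_ hε
  rw [mul_assoc C, ← mul_pow]
  refine mul_le_mul_of_nonneg_right (mul_le_mul_of_nonneg_left ?_ hC.le) (sq_nonneg ε)
  rw [inner_neg_right] at hdu'
  refine pow_le_pow_left₀ (by positivity) ?_ 2
  linarith [hwidth u]

/-- If `φ ≥ η` on the ball, the excess inherits the second-difference bound of `φ`. -/
theorem integral_secondDiff_recourseValue_le (h1 : CompleteRecourse W)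
    (h2 : SufficientlyExpensive W q) {ρ ρ' η : ℝ} (hle : ρ' ≤ ρ)
    (h : ∀ t ∈ Metric.ball (0 : EuclideanSpace ℝ (Fin s)) ρ', η ≤ recourseValue W q t)
    (u : EuclideanSpace ℝ (Fin s)) (c ε : ℝ) :
    ∫ t in Metric.ball 0 ρ', secondDiff (fun t _ => recourseValue W q t) η u c ε t ≤
      ∫ t in Metric.ball 0 ρ, secondDiff (excess W q) η u c ε t := by
  have hint : ∀ {f : EuclideanSpace ℝ (Fin s) → ℝ} (R : ℝ), Continuous f →
      IntegrableOn f (Metric.ball 0 R) := fun R hf =>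
    (hf.continuousOn.integrableOn_compact (isCompact_closedBall 0 R)).mono_set
      Metric.ball_subset_closedBall
  have hce := continuous_secondDiff (continuous_excess h1 h2) η u c ε
  refine le_trans (setIntegral_mono_on (hint ρ' (continuous_secondDiff
    ((continuous_recourseValue h1 h2).comp continuous_fst) η u c ε)) (hint ρ' hce)
    measurableSet_ball fun t ht => ?_)
    (setIntegral_mono_set (hint ρ hce) (Filter.Eventually.of_forall
      (secondDiff_nonneg (convexOn_excess h1 h2) η u c ε))
      (Metric.ball_subset_ball hle).eventuallyLE)
  have hcenter : excess W q t η = recourseValue W q t - η :=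
    max_eq_right (sub_nonneg.2 (h t ht))
  have hl : recourseValue W q (t - ε • u) - (η + ε * c) ≤ excess W q (t - ε • u) (η + ε * c) :=
    le_max_right _ _
  have hr : recourseValue W q (t + ε • u) - (η - ε * c) ≤ excess W q (t + ε • u) (η - ε * c) :=
    le_max_right _ _
  rw [secondDiff, secondDiff, hcenter]
  linarith

theorem finite_indexPos : (indexPos W q).Finite :=
  finite_dualVertices.subset (Set.sep_subset _ _)

/-- Under the slope condition, some gradient with index in `I⁺` is uniformly transversal to the
direction `(u, c)`. -/
theorem exists_slope_bound (h1 : CompleteRecourse W) (h2 : SufficientlyExpensive W q) {η₀ : ℝ}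
    (hη₀ : 0 < η₀) {α' γ' : EuclideanSpace ℝ (Fin s) → ℝ} (hα' : IsLowerSlope W q η₀ α')
    (hγ' : IsCutSlope W q η₀ γ') {σ : ℝ} (hσ : 0 < σ) :
    ∃ κ : ℝ, 0 < κ ∧ ∀ (u : EuclideanSpace ℝ (Fin s)) (c : ℝ), u ≠ 0 →
      σ * ‖u‖ ≤ recourseValue W q u → -(slopeMax W q η₀ α' γ' / 3) * ‖u‖ ≤ c →
      ∃ d ∈ indexPos W q, κ * ‖u‖ ≤ |⟪d, u⟫_ℝ + c| := by
  set δ := slopeMax W q η₀ α' γ' with hδ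
  set I := (finite_indexPos (W := W) (q := q)).toFinset with hI
  have hmemI : ∀ d, d ∈ I ↔ d ∈ indexPos W q := fun d => Set.Finite.mem_toFinset _
  obtain ⟨M, hM, hMD, -⟩ := exists_recourseValue_sub_le h1 h2
  -- By homogeneity `‖u‖ = 1` suffices. Values `c ≥ M + 1` are left out for compactness; there any
  -- `d₀ ∈ I⁺` attaining `φ(u) > 0` gives a value at least `1`.
  set S : Set (EuclideanSpace ℝ (Fin s) × ℝ) :=
    (Metric.sphere 0 1 ∩ {u | σ ≤ recourseValue W q u}) ×ˢ Set.Icc (-(δ / 3)) (M + 1) with hS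
  have hScomp : IsCompact S := ((isCompact_sphere 0 1).inter_right
    (isClosed_le continuous_const (continuous_recourseValue h1 h2))).prod isCompact_Icc
  have hf : Continuous fun p : EuclideanSpace ℝ (Fin s) × ℝ => ∑ d ∈ I, |⟪d, p.1⟫_ℝ + p.2| := by
    fun_prop
  obtain ⟨a, ha, hbound⟩ := hScomp.exists_forall_le' hf.continuousOn (a := 0) (by
    rintro ⟨u, c⟩ ⟨⟨hu1, hu2⟩, hc, -⟩
    have hu1' : ‖u‖ = 1 := by simpa using hu1
    have hu2' : σ ≤ recourseValue W q u := hu2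
    have hpos : 0 < recourseValue W q u := hσ.trans_le hu2'
    refine lt_of_le_of_ne (Finset.sum_nonneg fun d _ => abs_nonneg _) fun h0 => ?_
    -- If the sum vanishes, every `d ∈ I⁺` has the value `-c = φ(u)` at `u`, so `δ ≤ φ(u) = -c ≤ δ /
    -- 3`, which is impossible for `φ(u) > 0`.
    have hzero := (Finset.sum_eq_zero_iff_of_nonneg fun d _ => abs_nonneg _).1 h0.symm
    have hz : ∀ d ∈ indexPos W q, ⟪d, u⟫_ℝ = -c := fun d hd => by
      have := abs_eq_zero.1 (hzero d ((hmemI d).2 hd))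
      linarith
    obtain ⟨d, hd, hdu⟩ := exists_indexPos_inner_eq h1 h2 hpos
    have hcu : -c = recourseValue W q u := by rw [← hdu, hz d hd]
    have := slopeMax_le_of_forall_inner_eq h1 h2 hη₀ hα' hγ' hpos
      (fun d hd => by rw [hz d hd, hcu])
    rw [hu1', div_one] at this
    change -(δ / 3) ≤ c at hc
    linarith)
  have hunit : ∃ κ : ℝ, 0 < κ ∧ ∀ (u : EuclideanSpace ℝ (Fin s)) (c : ℝ), ‖u‖ = 1 →
      σ ≤ recourseValue W q u → -(δ / 3) ≤ c →
      ∃ d ∈ indexPos W q, κ ≤ |⟪d, u⟫_ℝ + c| := by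
    refine ⟨min 1 (a / (I.card + 1)), by positivity, fun u c hu1 hu2 hc => ?_⟩
    obtain ⟨d₀, hd₀, hd₀u⟩ := exists_indexPos_inner_eq h1 h2 (hσ.trans_le hu2)
    rcases le_total c (M + 1) with hcM | hcM
    · have hsum := hbound (u, c) ⟨⟨by simpa using hu1, hu2⟩, hc, hcM⟩
      obtain ⟨d, hd, hle⟩ := Finset.exists_le_of_sum_le (s := I) ⟨d₀, (hmemI d₀).2 hd₀⟩
        (f := fun _ => a / (I.card + 1)) (g := fun d => |⟪d, u⟫_ℝ + c|) (by
          refine le_trans ?_ hsum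
          rw [Finset.sum_const, nsmul_eq_mul, mul_div_assoc', div_le_iff₀ (by positivity)]
          nlinarith)
      exact ⟨d, (hmemI d).1 hd, (min_le_right _ _).trans hle⟩
    · refine ⟨d₀, hd₀, (min_le_left _ _).trans (le_trans ?_ (le_abs_self _))⟩
      linarith [hσ.trans_le hu2]
  obtain ⟨κ, hκ, hκu⟩ := hunit
  refine ⟨κ, hκ, fun u c hu0 hu hc => ?_⟩
  have hn : 0 < ‖u‖ := norm_pos_iff.2 hu0
  obtain ⟨d, hd, hle⟩ := hκu (‖u‖⁻¹ • u) (‖u‖⁻¹ * c)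
    (by rw [norm_smul, norm_inv, norm_norm, inv_mul_cancel₀ hn.ne'])
    (by rwa [recourseValue_smul h1 h2 (inv_pos.2 hn), le_inv_mul_iff₀ hn, mul_comm])
    (by rwa [le_inv_mul_iff₀ hn, mul_comm])
  refine ⟨d, hd, ?_⟩
  rw [inner_smul_right, ← mul_add, abs_mul, abs_of_pos (inv_pos.2 hn), le_inv_mul_iff₀ hn] at hle
  rwa [mul_comm]

/-- Uniform second-difference bound for levels at which the excess vanishes on a fixed ball. -/
theorem exists_secondDiff_bound_of_zero_ball (h1 : CompleteRecourse W)
    (h2 : SufficientlyExpensive W q) {ρ η₀ : ℝ} (hρ : 0 < ρ) (hη₀ : 0 < η₀)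
    (h5 : ThresholdBound W q ρ η₀) {α' γ' : EuclideanSpace ℝ (Fin s) → ℝ}
    (hα' : IsLowerSlope W q η₀ α') (hγ' : IsCutSlope W q η₀ γ') {σ : ℝ} (hσ : 0 < σ)
    {t₀ : EuclideanSpace ℝ (Fin s)} {τ₀ η₁ : ℝ} (hτ₀ : 0 < τ₀)
    (hb₀ : Metric.ball t₀ τ₀ ⊆ Metric.ball 0 ρ)
    (hz : ∀ z ∈ Metric.ball t₀ τ₀, recourseValue W q z ≤ -η₁) :
    ∃ κ : ℝ, 0 < κ ∧ ∀ η, -η₁ < η → η ≤ η₀ → ∀ (u : EuclideanSpace ℝ (Fin s)) (c : ℝ), u ≠ 0 →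
      σ * ‖u‖ ≤ recourseValue W q u → -(slopeMax W q η₀ α' γ' / 3) * ‖u‖ ≤ c →
      ∀ᶠ ε in nhdsWithin (0 : ℝ) (Set.Ioi 0), κ * ‖u‖ ^ 2 * ε ^ 2 ≤
        ∫ t in Metric.ball 0 ρ, secondDiff (excess W q) η u c ε t := by
  obtain ⟨a, ha, hslope⟩ := exists_slope_bound h1 h2 hη₀ hα' hγ' hσ
  obtain ⟨M, hM, hMD, -⟩ := exists_recourseValue_sub_le h1 h2
  obtain ⟨τ₁, hτ₁, hball⟩ := exists_uniform_pos (finite_indexPos (W := W) (q := q))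
    (P := fun d τ => ∃ t, Metric.ball t τ ⊆ Metric.ball 0 ρ ∧ ∃ η₁, η₀ < η₁ ∧
      ∀ z ∈ Metric.ball t τ, z ∈ linCone W q d ∧ η₁ < ⟪d, z⟫_ℝ)
    (fun d τ τ' ⟨t, ha, η₁, hη₁, hb⟩ hle => ⟨t, (Metric.ball_subset_ball hle).trans ha, η₁, hη₁,
      fun z hz => hb z (Metric.ball_subset_ball hle hz)⟩)
    (fun d hd => by
      obtain ⟨t, τ, hτ, h⟩ := exists_ball_above_threshold h1 h2 hη₀ h5 hd
      exact ⟨τ, hτ, t, h⟩)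
  obtain ⟨C, hC, hbound⟩ := exists_const_le_integral_secondDiff
    (E := EuclideanSpace ℝ (Fin s)) (lt_min hτ₀ hτ₁) hρ hM
  have hle₀ := Metric.ball_subset_ball (x := t₀) (min_le_left τ₀ τ₁)
  refine ⟨C * a ^ 2, by positivity, fun η hη hηle u c hu0 hu hc => ?_⟩
  obtain ⟨d, hd, hda⟩ := hslope u c hu0 hu hc
  obtain ⟨t, ht, η', hη', htK⟩ := hball d hd
  have hle := Metric.ball_subset_ball (x := t) (min_le_right τ₀ τ₁)
  -- The excess has gradient `(0, 0)` on the ball around `t₀` and `(d, -1)` on the ball around `t`.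
  filter_upwards [hbound _ (convexOn_excess h1 h2) (continuous_excess h1 h2) η t₀ t 0 d 0 (-1)
    ((isLinearNear_excess_of_le hη hz).mono (min_le_left _ _))
    ((isLinearNear_excess_of_gt h1 h2 hd.1 (hηle.trans_lt hη') htK).mono (min_le_right _ _))
    (hle₀.trans hb₀) (hle.trans ht) (by simpa using hM.le) (hMD d hd.1.1) u c] with ε hε
  refine le_trans ?_ hε
  rw [mul_assoc C, ← mul_pow]
  refine mul_le_mul_of_nonneg_right (mul_le_mul_of_nonneg_left ?_ hC.le) (sq_nonneg ε)
  have : -1 * c - ⟪d, u⟫_ℝ - (0 * c - ⟪(0 : EuclideanSpace ℝ (Fin s)), u⟫_ℝ)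
      = -(⟪d, u⟫_ℝ + c) := by rw [inner_zero_left]; ring
  rw [this, neg_sq, ← sq_abs (⟪d, u⟫_ℝ + c)]
  exact pow_le_pow_left₀ (by positivity) hda 2

/-- Uniform second-difference bound for positive levels if `φ ≤ 0` has empty interior. -/
theorem exists_secondDiff_bound_of_interior_eq_empty (h1 : CompleteRecourse W)
    (h2 : SufficientlyExpensive W q) {ρ η₀ : ℝ} (hρ : 0 < ρ) (hη₀ : 0 < η₀)
    (h5 : ThresholdBound W q ρ η₀)
    (hemp : interior {t : EuclideanSpace ℝ (Fin s) | recourseValue W q t ≤ 0} = ∅) :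
    ∃ κ : ℝ, 0 < κ ∧ ∀ η ≤ η₀, ∀ (u : EuclideanSpace ℝ (Fin s)) (c : ℝ),
      ∀ᶠ ε in nhdsWithin (0 : ℝ) (Set.Ioi 0), κ * ‖u‖ ^ 2 * ε ^ 2 ≤
        ∫ t in Metric.ball 0 ρ, secondDiff (excess W q) η u c ε t := by
  obtain ⟨σ, hσ, hwidth⟩ := width_le h1 h2
  obtain ⟨M, hM, hMD, -⟩ := exists_recourseValue_sub_le h1 h2
  obtain ⟨τ, hτ, hball⟩ := exists_uniform_pos (finite_indexPos (W := W) (q := q))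
    (P := fun d τ => ∃ t, Metric.ball t τ ⊆ Metric.ball 0 ρ ∧ ∃ η₁, η₀ < η₁ ∧
      ∀ z ∈ Metric.ball t τ, z ∈ linCone W q d ∧ η₁ < ⟪d, z⟫_ℝ)
    (fun d τ τ' ⟨t, ha, η₁, hη₁, hb⟩ hle => ⟨t, (Metric.ball_subset_ball hle).trans ha, η₁, hη₁,
      fun z hz => hb z (Metric.ball_subset_ball hle hz)⟩)
    (fun d hd => by
      obtain ⟨t, τ, hτ, h⟩ := exists_ball_above_threshold h1 h2 hη₀ h5 hd
      exact ⟨τ, hτ, t, h⟩)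
  obtain ⟨C, hC, hbound⟩ := exists_const_le_integral_secondDiff
    (E := EuclideanSpace ℝ (Fin s)) hτ hρ hM
  refine ⟨C * (2 * σ) ^ 2, by positivity, fun η hη u c => ?_⟩
  obtain ⟨d, hd, hdint, hdu⟩ := exists_full_dualVertex_inner_eq h1 h2 u
  obtain ⟨d', hd', hdint', hdu'⟩ := exists_full_dualVertex_inner_eq h1 h2 (-u)
  obtain ⟨t, hta, η₁, hη₁, htb⟩ :=
    hball d (mem_indexPos_of_interior_eq_empty h1 h2 hemp hd hdint)
  obtain ⟨t', hta', η₁', hη₁', htb'⟩ :=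
    hball d' (mem_indexPos_of_interior_eq_empty h1 h2 hemp hd' hdint')
  -- Both pieces lie above the threshold, so the contributions of `c` cancel and no slope condition
  -- is needed.
  filter_upwards [hbound _ (convexOn_excess h1 h2) (continuous_excess h1 h2) η t t' d d' (-1) (-1)
    (isLinearNear_excess_of_gt h1 h2 hd (hη.trans_lt hη₁) htb)
    (isLinearNear_excess_of_gt h1 h2 hd' (hη.trans_lt hη₁') htb')
    hta hta' (hMD d hd.1) (hMD d' hd'.1) u c] with ε hε
  refine le_trans ?_ hε
  rw [mul_assoc C, ← mul_pow]
  refine mul_le_mul_of_nonneg_right (mul_le_mul_of_nonneg_left ?_ hC.le) (sq_nonneg ε)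
  rw [inner_neg_right] at hdu'
  refine pow_le_pow_left₀ (by positivity) ?_ 2
  linarith [hwidth u]

/-- A functional separating `0` strictly from the dual polyhedron is negative on all of it, hence so
is its support function there. -/
theorem exists_recourseValue_neg (h1 : CompleteRecourse W) (h2 : SufficientlyExpensive W q)
    (h0 : (0 : EuclideanSpace ℝ (Fin s)) ∉ dualPolyhedron W q) :
    ∃ t : EuclideanSpace ℝ (Fin s), recourseValue W q t < 0 := by
  obtain ⟨f, a, hfa, ha⟩ := geometric_hahn_banach_closed_point convex_dualPolyhedron
    isClosed_dualPolyhedron h0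
  rw [map_zero] at ha
  refine ⟨(InnerProductSpace.toDual ℝ _).symm f, ?_⟩
  obtain ⟨v, hv, hvt⟩ := exists_mem_dualPolyhedron_inner_eq h1 h2
    ((InnerProductSpace.toDual ℝ (EuclideanSpace ℝ (Fin s))).symm f)
  rw [← hvt, real_inner_comm, InnerProductSpace.toDual_symm_apply]
  exact (hfa v hv).trans ha

/-- The uniform second-difference bound for the excess at all levels up to the threshold. -/
theorem exists_secondDiff_excess_bound (h1 : CompleteRecourse W)
    (h2 : SufficientlyExpensive W q) {ρ η₀ : ℝ} (hρ : 0 < ρ) (hη₀ : 0 < η₀)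
    (h5 : ThresholdBound W q ρ η₀) {α' γ' : EuclideanSpace ℝ (Fin s) → ℝ}
    (hα' : IsLowerSlope W q η₀ α') (hγ' : IsCutSlope W q η₀ γ') {σ : ℝ} (hσ : 0 < σ) :
    ∃ κ : ℝ, 0 < κ ∧ ∀ η ≤ η₀, ∀ (u : EuclideanSpace ℝ (Fin s)) (c : ℝ), u ≠ 0 →
      σ * ‖u‖ ≤ recourseValue W q u → -(slopeMax W q η₀ α' γ' / 3) * ‖u‖ ≤ c →
      ∀ᶠ ε in nhdsWithin (0 : ℝ) (Set.Ioi 0), κ * ‖u‖ ^ 2 * ε ^ 2 ≤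
        ∫ t in Metric.ball 0 ρ, secondDiff (excess W q) η u c ε t := by
  have hweak : ∀ {κ κ' u ε x : ℝ}, κ' ≤ κ → κ * u ^ 2 * ε ^ 2 ≤ x → κ' * u ^ 2 * ε ^ 2 ≤ x :=
    fun hκ h => le_trans (mul_le_mul_of_nonneg_right
      (mul_le_mul_of_nonneg_right hκ (sq_nonneg _)) (sq_nonneg _)) h
  have hcont := continuous_recourseValue h1 h2
  have hscale : ∀ t : EuclideanSpace ℝ (Fin s), ∃ a : ℝ, 0 < a ∧ a • t ∈ Metric.ball 0 ρ := by
    intro t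
    have hc : Continuous fun e : ℝ => ‖e • t‖ := by fun_prop
    have hev := (hc.tendsto 0).eventually_lt_const (show ‖(0 : ℝ) • t‖ < ρ by simpa)
    obtain ⟨a, hlt, ha⟩ := ((hev.filter_mono nhdsWithin_le_nhds).and
      (self_mem_nhdsWithin (s := Set.Ioi (0 : ℝ)))).exists
    exact ⟨a, ha, mem_ball_zero_iff.2 hlt⟩
  -- If `0` is dual feasible then `φ ≥ 0`, and levels `η ≤ 0` reduce to `φ` itself. Otherwise `φ`
  -- has negative values and the split is made at some `-η₁ < 0`, which keeps the constants uniform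
  -- around level `0`.
  by_cases h0 : (0 : EuclideanSpace ℝ (Fin s)) ∈ dualPolyhedron W q
  · have hφ0 : ∀ t, 0 ≤ recourseValue W q t := fun t => by
      simpa using inner_le_recourseValue h1 h0 t
    obtain ⟨κ₁, hκ₁, hb₁⟩ := exists_secondDiff_recourseValue_bound h1 h2 hρ
    obtain ⟨κ₂, hκ₂, hb₂⟩ : ∃ κ : ℝ, 0 < κ ∧ ∀ η, 0 < η → η ≤ η₀ →
        ∀ (u : EuclideanSpace ℝ (Fin s)) (c : ℝ), u ≠ 0 →
        σ * ‖u‖ ≤ recourseValue W q u → -(slopeMax W q η₀ α' γ' / 3) * ‖u‖ ≤ c →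
        ∀ᶠ ε in nhdsWithin (0 : ℝ) (Set.Ioi 0), κ * ‖u‖ ^ 2 * ε ^ 2 ≤
          ∫ t in Metric.ball 0 ρ, secondDiff (excess W q) η u c ε t := by
      rcases Set.eq_empty_or_nonempty
        (interior {t : EuclideanSpace ℝ (Fin s) | recourseValue W q t ≤ 0}) with hemp | ⟨w, hw⟩
      · obtain ⟨κ, hκ, hb⟩ := exists_secondDiff_bound_of_interior_eq_empty h1 h2 hρ hη₀ h5 hemp
        exact ⟨κ, hκ, fun η _ hη u c _ _ _ => hb η hη u c⟩
      · obtain ⟨a, ha, haw⟩ := hscale w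
        have hopen : IsOpen ((fun z : EuclideanSpace ℝ (Fin s) => a⁻¹ • z) ⁻¹'
            interior {t : EuclideanSpace ℝ (Fin s) | recourseValue W q t ≤ 0}) :=
          isOpen_interior.preimage (continuous_const_smul _)
        obtain ⟨τ, hτ, hsub⟩ := Metric.isOpen_iff.1 (Metric.isOpen_ball.inter hopen) (a • w)
          ⟨haw, by
            change a⁻¹ • a • w ∈
              interior {t : EuclideanSpace ℝ (Fin s) | recourseValue W q t ≤ 0}
            rwa [smul_smul, inv_mul_cancel₀ ha.ne', one_smul]⟩
        obtain ⟨κ, hκ, hb⟩ := exists_secondDiff_bound_of_zero_ball h1 h2 hρ hη₀ h5 hα' hγ' hσ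
          (η₁ := 0) hτ (fun z hz => (hsub hz).1) (fun z hz => by
            have hmem : a⁻¹ • z ∈ {t : EuclideanSpace ℝ (Fin s) | recourseValue W q t ≤ 0} :=
              interior_subset (hsub hz).2
            have hz' : recourseValue W q (a⁻¹ • z) ≤ 0 := hmem
            rw [recourseValue_smul h1 h2 (inv_pos.2 ha)] at hz'
            rw [neg_zero]
            exact nonpos_of_mul_nonpos_right hz' (inv_pos.2 ha))
        exact ⟨κ, hκ, fun η h => hb η (by rwa [neg_zero])⟩
    refine ⟨min κ₁ κ₂, lt_min hκ₁ hκ₂, fun η hη u c hu0 hu hc => ?_⟩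
    rcases le_or_gt η 0 with hneg | hpos
    · filter_upwards [hb₁ η u c] with ε hε
      exact hweak (min_le_left _ _) (hε.trans (integral_secondDiff_recourseValue_le h1 h2 le_rfl
        (fun t _ => hneg.trans (hφ0 t)) u c ε))
    · filter_upwards [hb₂ η hpos hη u c hu0 hu hc] with ε hε using hweak (min_le_right _ _) hε
  · obtain ⟨w, hw⟩ := exists_recourseValue_neg h1 h2 h0
    obtain ⟨M, hM, -, hlip⟩ := exists_recourseValue_sub_le h1 h2
    obtain ⟨a, ha, haw⟩ := hscale w
    have hneg : recourseValue W q (a • w) < 0 := by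
      rw [recourseValue_smul h1 h2 ha]; exact mul_neg_of_pos_of_neg ha hw
    obtain ⟨η₁, hη₁, hlt⟩ : ∃ η₁, 0 < η₁ ∧ recourseValue W q (a • w) < -η₁ :=
      ⟨-recourseValue W q (a • w) / 2, by linarith, by linarith⟩
    obtain ⟨τ, hτ, hsub⟩ := Metric.isOpen_iff.1
      (Metric.isOpen_ball.inter (isOpen_lt hcont continuous_const)) (a • w) ⟨haw, hlt⟩
    obtain ⟨κ₂, hκ₂, hb₂⟩ := exists_secondDiff_bound_of_zero_ball h1 h2 hρ hη₀ h5 hα' hγ' hσ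
      (η₁ := η₁) hτ (fun z hz => (hsub hz).1)
      (fun z hz => (show recourseValue W q z < -η₁ from (hsub hz).2).le)
    -- On the ball of radius `η₁ / M` the Lipschitz bound gives `φ ≥ -η₁`, so for `η ≤ -η₁` the
    -- excess equals `φ - η` there.
    obtain ⟨κ₁, hκ₁, hb₁⟩ := exists_secondDiff_recourseValue_bound h1 h2
      (lt_min hρ (div_pos hη₁ hM))
    refine ⟨min κ₁ κ₂, lt_min hκ₁ hκ₂, fun η hη u c hu0 hu hc => ?_⟩
    rcases le_or_gt η (-η₁) with hle | hgt
    · filter_upwards [hb₁ η u c] with ε hε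
      refine hweak (min_le_left _ _) (hε.trans (integral_secondDiff_recourseValue_le h1 h2
        (min_le_left _ _) (fun t ht => hle.trans ?_) u c ε))
      have h3 := hlip t 0
      rw [recourseValue_zero h1 h2, sub_zero, sub_zero] at h3
      have h4 : ‖t‖ < η₁ / M := (mem_ball_zero_iff.1 ht).trans_le (min_le_right _ _)
      rw [lt_div_iff₀' hM] at h4
      linarith [(abs_le.1 h3).1]
    · filter_upwards [hb₂ η hgt hη u c hu0 hu hc] with ε hε using hweak (min_le_right _ _) hε

end UniformBounds

/-! ### From second differences to strong convexity of the expected excess. -/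

section StrongConvexity

open scoped InnerProductSpace

/-- A continuous function whose second differences are eventually at least `κ ε²` satisfies the
strong convexity inequality on `[0, 1]`. -/
theorem strongConvex_ineq_of_secondDiff {h : ℝ → ℝ} (hc : Continuous h) {κ : ℝ}
    (H : ∀ x ∈ Set.Ioo (0 : ℝ) 1, ∀ᶠ ε in nhdsWithin (0 : ℝ) (Set.Ioi 0),
      κ * ε ^ 2 ≤ h (x + ε) + h (x - ε) - 2 * h x)
    {l : ℝ} (hl : l ∈ Set.Ioo (0 : ℝ) 1) :
    h l ≤ l * h 1 + (1 - l) * h 0 - κ / 2 * l * (1 - l) := by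
  set k : ℝ → ℝ := fun x => h x - (x * h 1 + (1 - x) * h 0 - κ / 2 * x * (1 - x)) with hk
  have hkc : Continuous k := by fun_prop
  have k0 : k 0 = 0 := by simp [hk]
  have k1 : k 1 = 0 := by simp [hk]
  by_contra! hcon
  have hkl : 0 < k l := sub_pos.2 hcon
  obtain ⟨y, hy, hmax⟩ := isCompact_Icc.exists_isMaxOn (Set.nonempty_Icc.2 zero_le_one)
    (hkc.continuousOn (s := Set.Icc (0 : ℝ) 1))
  have hyl : 0 < k y := hkl.trans_le (hmax (Set.Ioo_subset_Icc_self hl))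
  have hScomp : IsCompact (Set.Icc (0 : ℝ) 1 ∩ {x | k x = k y}) :=
    isCompact_Icc.inter_right (isClosed_eq hkc continuous_const)
  -- At the rightmost maximizer of `k` the value at `x + ε` is strictly smaller, so the second
  -- difference of `k` is negative, although the hypothesis makes it nonnegative. A weak inequality
  -- in the hypothesis is therefore enough.
  obtain ⟨x, ⟨hx, hxy⟩, hgreat⟩ := hScomp.exists_isGreatest ⟨y, hy, rfl⟩
  change k x = k y at hxy
  have hx0 : 0 < x := lt_of_le_of_ne hx.1 fun h => by rw [← h, k0] at hxy; linarith
  have hx1 : x < 1 := lt_of_le_of_ne hx.2 fun h => by rw [h, k1] at hxy; linarith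
  obtain ⟨ε, hε, hε0, hε1⟩ := ((H x ⟨hx0, hx1⟩).and
    (Ioc_mem_nhdsGT (lt_min hx0 (sub_pos.2 hx1)))).exists
  have hεx := hε1.trans (min_le_left _ _)
  have hεx' := hε1.trans (min_le_right _ _)
  have hp : x + ε ∈ Set.Icc (0 : ℝ) 1 := ⟨by linarith, by linarith⟩
  have hm : x - ε ∈ Set.Icc (0 : ℝ) 1 := ⟨by linarith, by linarith⟩
  have hlt : k (x + ε) < k y := lt_of_le_of_ne (hmax hp) fun heq => by
    have := hgreat ⟨hp, heq⟩
    linarith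
  have hle : k (x - ε) ≤ k y := hmax hm
  have : k (x + ε) + k (x - ε) - 2 * k x
      = h (x + ε) + h (x - ε) - 2 * h x - κ * ε ^ 2 := by
    simp only [hk]; ring
  linarith

variable {s m : ℕ} {W : Matrix (Fin s) (Fin m) ℝ} {q : Fin m → ℝ}
  {μ : Measure (EuclideanSpace ℝ (Fin s))}

theorem integrable_excess [IsProbabilityMeasure μ] (h1 : CompleteRecourse W)
    (h2 : SufficientlyExpensive W q)
    (h3 : Integrable (fun z : EuclideanSpace ℝ (Fin s) => ‖z‖) μ)
    (x : EuclideanSpace ℝ (Fin s)) (η : ℝ) : Integrable (fun z => excess W q (z - x) η) μ := by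
  obtain ⟨M, hM, -, hlip⟩ := exists_recourseValue_sub_le h1 h2
  have hc : Continuous fun z => excess W q (z - x) η :=
    (continuous_excess h1 h2).comp (f := fun z => (z - x, η)) (by fun_prop)
  refine Integrable.mono' ((h3.const_mul M).add (integrable_const (M * ‖x‖ + |η|)))
    hc.aestronglyMeasurable (Filter.Eventually.of_forall fun z => ?_)
  have ha := hlip (z - x) 0
  rw [recourseValue_zero h1 h2, sub_zero, sub_zero] at ha
  have hb := mul_le_mul_of_nonneg_left (norm_sub_le z x) hM.le
  rw [excess, Real.norm_eq_abs, abs_of_nonneg (le_max_left _ _)]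
  change max 0 _ ≤ M * ‖z‖ + (M * ‖x‖ + |η|)
  refine max_le (by positivity) ?_
  linarith [le_abs_self (recourseValue W q (z - x)), neg_abs_le η]

theorem expectedExcess_eq (p : EuclideanSpace ℝ (Fin s) × ℝ) :
    expectedExcess W q μ p = ∫ z, excess W q (z - p.1) p.2 ∂μ := rfl

theorem continuous_expectedExcess [IsProbabilityMeasure μ] (h1 : CompleteRecourse W)
    (h2 : SufficientlyExpensive W q)
    (h3 : Integrable (fun z : EuclideanSpace ℝ (Fin s) => ‖z‖) μ) :
    Continuous (expectedExcess W q μ) := by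
  obtain ⟨M, hM, -, hlip⟩ := exists_recourseValue_sub_le h1 h2
  refine (LipschitzWith.of_dist_le_mul (K := ⟨M + 1, by positivity⟩) fun p p' => ?_).continuous
  rw [Real.dist_eq, expectedExcess_eq, expectedExcess_eq,
    ← integral_sub (integrable_excess h1 h2 h3 _ _) (integrable_excess h1 h2 h3 _ _),
    ← Real.norm_eq_abs]
  refine (norm_integral_le_of_norm_le_const (Filter.Eventually.of_forall fun z => ?_)).trans
    (le_of_eq (by rw [probReal_univ, mul_one]))
  change |max 0 _ - max 0 _| ≤ (M + 1) * dist p p'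
  rw [max_comm 0, max_comm 0]
  refine (abs_max_sub_max_le_abs _ _ _).trans ?_
  have ha := hlip (z - p.1) (z - p'.1)
  rw [sub_sub_sub_cancel_left, ← dist_eq_norm, dist_comm] at ha
  have hb : dist p.1 p'.1 ≤ dist p p' := le_max_left _ _
  have hc : |p.2 - p'.2| ≤ dist p p' := (Real.dist_eq p.2 p'.2) ▸ le_max_right _ _
  have hd := mul_le_mul_of_nonneg_left hb hM.le
  calc |recourseValue W q (z - p.1) - p.2 - (recourseValue W q (z - p'.1) - p'.2)|
      = |(recourseValue W q (z - p.1) - recourseValue W q (z - p'.1)) - (p.2 - p'.2)| := by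
        congr 1; ring
    _ ≤ _ := (abs_sub _ _).trans (by linarith)

theorem expectedExcess_convex [IsProbabilityMeasure μ] (h1 : CompleteRecourse W)
    (h2 : SufficientlyExpensive W q)
    (h3 : Integrable (fun z : EuclideanSpace ℝ (Fin s) => ‖z‖) μ)
    (p p' : EuclideanSpace ℝ (Fin s) × ℝ) {l : ℝ} (hl0 : 0 < l) (hl1 : l < 1) :
    expectedExcess W q μ (l • p + (1 - l) • p') ≤
      l * expectedExcess W q μ p + (1 - l) * expectedExcess W q μ p' := by
  simp only [expectedExcess_eq]
  rw [← integral_const_mul, ← integral_const_mul,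
    ← integral_add ((integrable_excess h1 h2 h3 _ _).const_mul _)
      ((integrable_excess h1 h2 h3 _ _).const_mul _)]
  refine integral_mono (integrable_excess h1 h2 h3 _ _)
    (((integrable_excess h1 h2 h3 _ _).const_mul _).add
      ((integrable_excess h1 h2 h3 _ _).const_mul _)) fun z => ?_
  have := (convexOn_excess h1 h2).2 (Set.mem_univ (z - p.1, p.2)) (Set.mem_univ (z - p'.1, p'.2))
    hl0.le (sub_pos.2 hl1).le (by ring)
  have e : z - (l • p + (1 - l) • p').1 = (l • (z - p.1, p.2) + (1 - l) • (z - p'.1, p'.2)).1 := by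
    simp only [Prod.fst_add, Prod.smul_fst]; module
  change excess W q (z - (l • p + (1 - l) • p').1) _ ≤ _
  rw [e]
  exact this

theorem smul_restrict_ball_le_of_hasDensityBound {V : Set (EuclideanSpace ℝ (Fin s))} {r ρ : ℝ}
    (h4 : HasDensityBound μ V r ρ) {x : EuclideanSpace ℝ (Fin s)} (hx : x ∈ V) :
    ENNReal.ofReal r • (volume.restrict (Metric.ball x ρ)) ≤ μ := by
  obtain ⟨θ, -, -, hμ, hr⟩ := h4
  rw [hμ, ← withDensity_const, ← withDensity_indicator measurableSet_ball]
  refine withDensity_mono ?_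
  filter_upwards [hr] with z hz
  by_cases hmem : z ∈ Metric.ball x ρ
  · rw [Set.indicator_of_mem hmem]
    refine ENNReal.ofReal_le_ofReal (hz ⟨x, hx, z - x, ?_, add_sub_cancel _ _⟩)
    rwa [mem_ball_zero_iff, ← mem_ball_iff_norm]
  · rw [Set.indicator_of_notMem hmem]
    exact zero_le

theorem integral_ball_le_integral {V : Set (EuclideanSpace ℝ (Fin s))} {r ρ : ℝ} (hr : 0 < r)
    (h4 : HasDensityBound μ V r ρ) {x : EuclideanSpace ℝ (Fin s)} (hx : x ∈ V)
    {f : EuclideanSpace ℝ (Fin s) → ℝ} (hf0 : ∀ t, 0 ≤ f t)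
    (hint : Integrable (fun z => f (z - x)) μ) :
    r * ∫ t in Metric.ball 0 ρ, f t ≤ ∫ z, f (z - x) ∂μ := by
  have := integral_mono_measure (smul_restrict_ball_le_of_hasDensityBound h4 hx)
    (Filter.Eventually.of_forall fun z => hf0 (z - x)) hint
  rw [integral_smul_measure, ENNReal.toReal_ofReal hr.le, smul_eq_mul] at this
  refine le_trans (le_of_eq ?_) this
  have hpre : (fun z => z - x) ⁻¹' (Metric.ball 0 ρ) = Metric.ball x ρ := by
    ext z
    simp [dist_eq_norm]
  rw [← hpre, (measurePreserving_sub_right volume x).setIntegral_preimage_emb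
    (measurableEmbedding_subRight x) f]

theorem expectedExcess_secondDiff [IsProbabilityMeasure μ] (h1 : CompleteRecourse W)
    (h2 : SufficientlyExpensive W q)
    (h3 : Integrable (fun z : EuclideanSpace ℝ (Fin s) => ‖z‖) μ)
    (x u : EuclideanSpace ℝ (Fin s)) (η c ε : ℝ) :
    Integrable (fun z => secondDiff (excess W q) η u c ε (z - x)) μ ∧
    ∫ z, secondDiff (excess W q) η u c ε (z - x) ∂μ =
      expectedExcess W q μ (x + ε • u, η + ε * c) + expectedExcess W q μ (x - ε • u, η - ε * c)
        - 2 * expectedExcess W q μ (x, η) := by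
  have e : (fun z => secondDiff (excess W q) η u c ε (z - x)) = fun z =>
      excess W q (z - (x + ε • u)) (η + ε * c) + excess W q (z - (x - ε • u)) (η - ε * c)
        - 2 * excess W q (z - x) η := by
    funext z
    rw [secondDiff, sub_add_eq_sub_sub, sub_sub_eq_add_sub, sub_add_eq_add_sub]
  have i := fun x η => integrable_excess (μ := μ) h1 h2 h3 x η
  have i' : Integrable (fun z => excess W q (z - (x + ε • u)) (η + ε * c)
      + excess W q (z - (x - ε • u)) (η - ε * c)) μ := (i _ _).add (i _ _)
  rw [e]
  refine ⟨i'.sub ((i _ _).const_mul 2), ?_⟩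
  rw [integral_sub i' ((i _ _).const_mul 2), integral_add (i _ _) (i _ _),
    integral_const_mul]
  rfl

/-- Reduction to one variable: convexity of `V` keeps every intermediate `x` in `V`, where the
density bound applies on `x + B_ρ(0)`, and every intermediate level below `η₀`. -/
theorem expectedExcess_strongConvex_of_secondDiff [IsProbabilityMeasure μ]
    (h1 : CompleteRecourse W) (h2 : SufficientlyExpensive W q)
    (h3 : Integrable (fun z : EuclideanSpace ℝ (Fin s) => ‖z‖) μ)
    {V : Set (EuclideanSpace ℝ (Fin s))} {r ρ η₀ : ℝ} (hV : Convex ℝ V) (hr : 0 < r)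
    (h4 : HasDensityBound μ V r ρ) {p p' : EuclideanSpace ℝ (Fin s) × ℝ}
    (hp : p ∈ V ×ˢ Set.Iic η₀) (hp' : p' ∈ V ×ˢ Set.Iic η₀) {κ : ℝ}
    (H : ∀ η ≤ η₀, ∀ᶠ ε in nhdsWithin (0 : ℝ) (Set.Ioi 0), κ * ‖p'.1 - p.1‖ ^ 2 * ε ^ 2 ≤
      ∫ t in Metric.ball 0 ρ, secondDiff (excess W q) η (p'.1 - p.1) (p'.2 - p.2) ε t)
    {l : ℝ} (hl : l ∈ Set.Ioo (0 : ℝ) 1) :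
    expectedExcess W q μ (l • p' + (1 - l) • p) ≤
      l * expectedExcess W q μ p' + (1 - l) * expectedExcess W q μ p
        - (r * κ) / 2 * l * (1 - l) * ‖p'.1 - p.1‖ ^ 2 := by
  have hc : Continuous fun x : ℝ => expectedExcess W q μ (x • p' + (1 - x) • p) :=
    (continuous_expectedExcess h1 h2 h3).comp (by fun_prop)
  have key := strongConvex_ineq_of_secondDiff hc (κ := r * κ * ‖p'.1 - p.1‖ ^ 2) (fun x hx => by
    have hmem : x • p' + (1 - x) • p ∈ V ×ˢ Set.Iic η₀ :=
      (hV.prod (convex_Iic η₀)) hp' hp hx.1.le (sub_pos.2 hx.2).le (by ring)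
    filter_upwards [H _ hmem.2] with ε hε
    obtain ⟨hint, heq⟩ := expectedExcess_secondDiff (μ := μ) h1 h2 h3 (x • p' + (1 - x) • p).1
      (p'.1 - p.1) (x • p' + (1 - x) • p).2 (p'.2 - p.2) ε
    have hle := integral_ball_le_integral hr h4 hmem.1
      (secondDiff_nonneg (convexOn_excess h1 h2) _ _ _ ε) hint
    rw [heq] at hle
    have e1 : (x + ε) • p' + (1 - (x + ε)) • p = ((x • p' + (1 - x) • p).1 + ε • (p'.1 - p.1),
        (x • p' + (1 - x) • p).2 + ε * (p'.2 - p.2)) := by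
      ext1
      · simp only [Prod.fst_add, Prod.smul_fst]; module
      · simp only [Prod.snd_add, Prod.smul_snd, smul_eq_mul]; ring
    have e2 : (x - ε) • p' + (1 - (x - ε)) • p = ((x • p' + (1 - x) • p).1 - ε • (p'.1 - p.1),
        (x • p' + (1 - x) • p).2 - ε * (p'.2 - p.2)) := by
      ext1
      · simp only [Prod.fst_add, Prod.smul_fst]; module
      · simp only [Prod.snd_add, Prod.smul_snd, smul_eq_mul]; ring
    rw [e1, e2]
    refine le_trans ?_ hle
    rw [mul_assoc r, mul_assoc r]
    exact mul_le_mul_of_nonneg_left hε hr.le) hl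
  simp only [one_smul, sub_self, zero_smul, add_zero, sub_zero, zero_add] at key
  linarith

end StrongConvexity

end TwoStage

/-! ### Assembly of the main theorem. -/

theorem mainTheorem2 {s m : ℕ} (W : Matrix (Fin s) (Fin m) ℝ) (q : Fin m → ℝ)
    (μ : Measure (EuclideanSpace ℝ (Fin s))) [IsProbabilityMeasure μ]
    (V : Set (EuclideanSpace ℝ (Fin s))) (r ρ η₀ : ℝ)
    (hA1 : TwoStage.CompleteRecourse W)
    (hA2 : TwoStage.SufficientlyExpensive W q)
    (hA3 : Integrable (fun z : EuclideanSpace ℝ (Fin s) => ‖z‖) μ)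
    (hVconv : Convex ℝ V) (hVopen : IsOpen V) (hr : 0 < r) (hρ : 0 < ρ)
    (hA4 : TwoStage.HasDensityBound μ V r ρ)
    (hη₀ : 0 < η₀) (hA5 : TwoStage.ThresholdBound W q ρ η₀)
    (α' γ' : EuclideanSpace ℝ (Fin s) → ℝ)
    (hα' : TwoStage.IsLowerSlope W q η₀ α')
    (hγ' : TwoStage.IsCutSlope W q η₀ γ') :
    (∀ (x : EuclideanSpace ℝ (Fin s)) (η : ℝ),
      Integrable (fun z => max 0 (TwoStage.recourseValue W q (z - x) - η)) μ) ∧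
    ∃ κ : ℝ, 0 < κ ∧ ∀ Ω : Set (EuclideanSpace ℝ (Fin s) × ℝ),
      TwoStage.IsAdmissibleSet W q V η₀ (TwoStage.slopeMax W q η₀ α' γ') Ω →
      TwoStage.RestrictedPartiallyStronglyConvex κ Ω (TwoStage.expectedExcess W q μ) := by
  refine ⟨TwoStage.integrable_excess hA1 hA2 hA3, ?_⟩
  obtain ⟨σ, hσ, hwidth⟩ := TwoStage.width_le hA1 hA2
  obtain ⟨κ, hκ, hbound⟩ :=
    TwoStage.exists_secondDiff_excess_bound hA1 hA2 hρ hη₀ hA5 hα' hγ' hσ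
  refine ⟨r * κ, mul_pos hr hκ, fun Ω hΩ p₁ hp₁ p₂ hp₂ l hl0 hl1 => ?_⟩
  have main : ∀ p ∈ Ω, ∀ p' ∈ Ω, p'.1 - p.1 ≠ 0 →
      σ * ‖p'.1 - p.1‖ ≤ TwoStage.recourseValue W q (p'.1 - p.1) → ∀ l ∈ Set.Ioo (0 : ℝ) 1,
      TwoStage.expectedExcess W q μ (l • p' + (1 - l) • p) ≤
        l * TwoStage.expectedExcess W q μ p' + (1 - l) * TwoStage.expectedExcess W q μ p
          - (r * κ) / 2 * l * (1 - l) * ‖p'.1 - p.1‖ ^ 2 := by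
    intro p hp p' hp' hne hσu l hl
    -- Positivity of `φ` at the difference places it in some `K_i` with `i ∈ I⁺`, which activates
    -- the slope condition on `Ω`.
    obtain ⟨d, hd, hdu⟩ := TwoStage.exists_indexPos_inner_eq hA1 hA2
      ((mul_pos hσ (norm_pos_iff.2 hne)).trans_le hσu)
    have hslope := hΩ.2 p hp p' hp' d hd ((TwoStage.mem_linCone_iff hA1 hA2 hd.1 _).2 hdu)
    exact TwoStage.expectedExcess_strongConvex_of_secondDiff hA1 hA2 hA3 hVconv hr hA4
      (hΩ.1 hp) (hΩ.1 hp') (fun η hη => hbound η hη _ _ hne hσu hslope) hl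
  rcases eq_or_ne (p₁.1 - p₂.1) 0 with h0 | hne
  · rw [h0, norm_zero, zero_pow two_ne_zero, mul_zero, sub_zero]
    exact TwoStage.expectedExcess_convex hA1 hA2 hA3 p₁ p₂ hl0 hl1
  have hw := hwidth (p₁.1 - p₂.1)
  -- Since `φ(u) + φ(-u) ≥ 2σ‖u‖`, at least one orientation of the segment satisfies the hypothesis
  -- of `main`; the claim is symmetric under exchanging the end points and `l` with `1 - l`.
  rcases le_total (σ * ‖p₁.1 - p₂.1‖) (TwoStage.recourseValue W q (p₁.1 - p₂.1)) with hle | hle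
  · exact main p₂ hp₂ p₁ hp₁ hne hle l ⟨hl0, hl1⟩
  · have h := main p₁ hp₁ p₂ hp₂ (by rwa [← neg_sub, neg_ne_zero])
      (by rw [norm_sub_rev, ← neg_sub p₁.1 p₂.1]; linarith) (1 - l)
      ⟨sub_pos.2 hl1, by linarith⟩
    rw [sub_sub_cancel, norm_sub_rev, add_comm (_ • p₂)] at h
    linarith
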